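/- Let $\mu,\nu,\sigma,\tau>0$. For $k\ge 1$ let $$A(k)=\begin{pmatrix}\alpha_k&\beta_k\\ \gamma_k&\delta_k\end{pmatrix},$$ where all the random variables $\alpha_k,\beta_k,\gamma_k,\delta_k$ $(k\ge1)$ are mutually independent and $\alpha_k,\beta_k,\gamma_k,\delta_k$ are exponentially distributed with parameters (rates) $\mu,\nu,\sigma,\tau$ respectively. Let $x(0)=y(0)=0$ and, for $k\ge1$, $$x(k)=\max(x(k-1)+\alpha_k,\;y(k-1)+\beta_k),\qquad y(k)=\max(x(k-1)+\gamma_k,\;y(k-1)+\delta_k),$$ that is, $z(k)=A(k)z(k-1)$ in the max-plus semiring with $z(k)=(x(k),y(k))^T$. Define $$U_1=\begin{pmatrix}1&1&1\\ \frac{\mu}{\mu+\nu}&\frac12&\frac{\mu+\nu}{\mu+2\nu}\\ \frac{\mu}{\mu+\tau}&\frac{\nu}{\nu+\tau}&\frac{\mu+\nu}{\mu+\nu+\tau}\\ \frac{\mu}{\mu+\nu+\tau}&\frac{\nu}{2\nu+\tau}&\frac{\mu+\nu}{\mu+2\nu+\tau}\end{pmatrix},\qquad U_2=\begin{pmatrix}1&1&1\\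 \frac{\sigma}{\mu+\sigma}&\frac{\tau}{\mu+\tau}&\frac{\sigma+\tau}{\mu+\sigma+\tau}\\ \frac12&\frac{\tau}{\sigma+\tau}&\frac{\sigma+\tau}{2\sigma+\tau}\\ \frac{\sigma}{\mu+2\sigma}&\frac{\tau}{\mu+\sigma+\tau}&\frac{\sigma+\tau}{\mu+2\sigma+\tau}\end{pmatrix},$$ $$V_{11}=\begin{pmatrix}\frac{\sigma}{\mu+\sigma}&0&-\frac{\mu\sigma}{(\mu+\tau)(\mu+\sigma+\tau)}&0\\ 0&\frac{\sigma}{\nu+\sigma}&0&-\frac{\nu\sigma}{(\nu+\tau)(\nu+\sigma+\tau)}\\ 0&-\frac{\sigma}{\mu+\nu+\sigma}&0&\frac{\sigma(\mu+\nu)}{(\mu+\nu+\tau)(\mu+\nu+\sigma+\tau)}\end{pmatrix},$$ $$V_{12}=\begin{pmatrix}0&\frac{\tau}{\mu+\tau}&0&-\frac{\mu\tau}{(\mu+\sigma)(\mu+\sigma+\tau)}\\ \frac{\tau}{\nu+\tau}&0&-\frac{\nu\tau}{(\nu+\sigma)(\nu+\sigma+\tau)}&0\\ 0&-\frac{\tau}{\mu+\nu+\tau}&0&\frac{\tau(\mu+\nu)}{(\mu+\nu+\sigma)(\mu+\nu+\sigma+\tau)}\end{pmatrix},$$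 $$V_{21}=\begin{pmatrix}\frac{\mu}{\mu+\sigma}&-\frac{\mu\sigma}{(\nu+\sigma)(\mu+\nu+\sigma)}&0&0\\ 0&0&\frac{\mu}{\mu+\tau}&-\frac{\mu\tau}{(\nu+\tau)(\mu+\nu+\tau)}\\ 0&0&-\frac{\mu}{\mu+\sigma+\tau}&\frac{\mu(\sigma+\tau)}{(\nu+\sigma+\tau)(\mu+\nu+\sigma+\tau)}\end{pmatrix},$$ $$V_{22}=\begin{pmatrix}0&0&\frac{\nu}{\nu+\sigma}&-\frac{\nu\sigma}{(\mu+\sigma)(\mu+\nu+\sigma)}\\ \frac{\nu}{\nu+\tau}&-\frac{\nu\tau}{(\mu+\tau)(\mu+\nu+\tau)}&0&0\\ 0&0&-\frac{\nu}{\nu+\sigma+\tau}&\frac{\nu(\sigma+\tau)}{(\mu+\sigma+\tau)(\mu+\nu+\sigma+\tau)}\end{pmatrix},$$ $$W=\begin{pmatrix}U_1V_{11}&U_1V_{12}\\ U_2V_{21}&U_2V_{22}\end{pmatrix}\in\mathbb R^{8\times8},$$ $$q_1=\begin{pmatrix}\frac{\mu^2+\mu\sigma+\sigma^2}{\mu\sigma(\mu+\sigma)}\\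 \frac{\mu\sigma(\mu+2\nu+\sigma)}{\nu(\mu+\nu)(\nu+\sigma)(\mu+\nu+\sigma)}\\ \frac{\mu\sigma(\mu+\sigma+2\tau)}{\tau(\mu+\tau)(\sigma+\tau)(\mu+\sigma+\tau)}\\ -\frac{\mu\sigma(\mu+2\nu+2\tau+\sigma)}{(\nu+\tau)(\mu+\nu+\tau)(\nu+\sigma+\tau)(\mu+\nu+\sigma+\tau)}\end{pmatrix},\qquad q_2=\begin{pmatrix}\frac{\nu^2+\nu\tau+\tau^2}{\nu\tau(\nu+\tau)}\\ \frac{\nu\tau(2\mu+\nu+\tau)}{\mu(\mu+\nu)(\mu+\tau)(\mu+\nu+\tau)}\\ \frac{\nu\tau(\nu+2\sigma+\tau)}{\sigma(\nu+\sigma)(\sigma+\tau)(\nu+\sigma+\tau)}\\ -\frac{\nu\tau(2\mu+\nu+2\sigma+\tau)}{(\mu+\sigma)(\mu+\nu+\sigma)(\mu+\sigma+\tau)(\mu+\nu+\sigma+\tau)}\end{pmatrix}.$$ Then the linear system $$(I-W)\omega=0,\qquad \omega_{10}+\omega_{20}=1,$$ for $\omega=(\omega_1^T,\omega_2^T)^T\in\mathbb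 R^8$ with $\omega_i=(\omega_{i0},\omega_{i1},\omega_{i2},\omega_{i3})^T$, has exactly one solution, and for this solution the Lyapunov exponent of the system is $q_1^T\omega_1+q_2^T\omega_2$: almost surely, $$\lambda=\lim_{k\to\infty}\frac1k\max(x(k),y(k))=q_1^T\omega_1+q_2^T\omega_2 .$$ -/

import Mathlib

open MeasureTheory ProbabilityTheory Filter Topology
open scoped Matrix

namespace MaxPlus

/-- One step of the max-plus linear recursion: the product of a `2 × 2` matrix and a vector
`z = (x, y)` in the semiring with maximum as addition and `+` as multiplication. -/
def mulVec (A : Matrix (Fin 2) (Fin 2) ℝ) (z : Fin 2 → ℝ) : Fin 2 → ℝ :=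
  fun i => max (z 0 + A i 0) (z 1 + A i 1)

/-- The trajectory `z(0) = (0, 0)`, `z(k) = A(k) z(k - 1)` for `k = 1, 2, …`, of the max-plus
system driven by the matrices `A(1), A(2), …`. -/
def state (A : ℕ+ → Matrix (Fin 2) (Fin 2) ℝ) : ℕ → Fin 2 → ℝ
  | 0 => 0
  | k + 1 => mulVec (A k.succPNat) (state A k)

/-- `lam` is the Lyapunov exponent of the random max-plus system: with probability one,
`max (x(k), y(k)) / k` tends to `lam`. -/
def IsLyapunovExponent {Ω : Type*} [MeasurableSpace Ω] (P : Measure Ω)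
    (A : ℕ+ → Ω → Matrix (Fin 2) (Fin 2) ℝ) (lam : ℝ) : Prop :=
  ∀ᵐ s ∂P, Tendsto
    (fun k : ℕ => (1 / (k : ℝ)) *
      max (state (fun n => A n s) k 0) (state (fun n => A n s) k 1))
    atTop (𝓝 lam)

/-- The general second-order exponential system: all the entries of all the matrices
`A(k) = (α_k, β_k; γ_k, δ_k)`, `k = 1, 2, …`, are mutually independent, and `α_k`, `β_k`, `γ_k`,
`δ_k` are exponentially distributed with parameters (rates) `μ`, `ν`, `σ`, `τ`. -/
structure IsExponentialSystem {Ω : Type*} [MeasurableSpace Ω] (P : Measure Ω)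
    (A : ℕ+ → Ω → Matrix (Fin 2) (Fin 2) ℝ) (μ ν σ τ : ℝ) : Prop where
  indep : iIndepFun (fun (p : ℕ+ × Fin 2 × Fin 2) (s : Ω) => A p.1 s p.2.1 p.2.2) P
  law_alpha : ∀ k, HasLaw (fun s => A k s 0 0) (expMeasure μ) P
  law_beta : ∀ k, HasLaw (fun s => A k s 0 1) (expMeasure ν) P
  law_gamma : ∀ k, HasLaw (fun s => A k s 1 0) (expMeasure σ) P
  law_delta : ∀ k, HasLaw (fun s => A k s 1 1) (expMeasure τ) P

noncomputable section

def U₁ (μ ν τ : ℝ) : Matrix (Fin 4) (Fin 3) ℝ :=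
  !![1, 1, 1;
     μ / (μ + ν), 1 / 2, (μ + ν) / (μ + 2 * ν);
     μ / (μ + τ), ν / (ν + τ), (μ + ν) / (μ + ν + τ);
     μ / (μ + ν + τ), ν / (2 * ν + τ), (μ + ν) / (μ + 2 * ν + τ)]

def U₂ (μ σ τ : ℝ) : Matrix (Fin 4) (Fin 3) ℝ :=
  !![1, 1, 1;
     σ / (μ + σ), τ / (μ + τ), (σ + τ) / (μ + σ + τ);
     1 / 2, τ / (σ + τ), (σ + τ) / (2 * σ + τ);
     σ / (μ + 2 * σ), τ / (μ + σ + τ), (σ + τ) / (μ + 2 * σ + τ)]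

def V₁₁ (μ ν σ τ : ℝ) : Matrix (Fin 3) (Fin 4) ℝ :=
  !![σ / (μ + σ), 0, -(μ * σ / ((μ + τ) * (μ + σ + τ))), 0;
     0, σ / (ν + σ), 0, -(ν * σ / ((ν + τ) * (ν + σ + τ)));
     0, -(σ / (μ + ν + σ)), 0, σ * (μ + ν) / ((μ + ν + τ) * (μ + ν + σ + τ))]

def V₁₂ (μ ν σ τ : ℝ) : Matrix (Fin 3) (Fin 4) ℝ :=
  !![0, τ / (μ + τ), 0, -(μ * τ / ((μ + σ) * (μ + σ + τ)));
     τ / (ν + τ), 0, -(ν * τ / ((ν + σ) * (ν + σ + τ))), 0;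
     0, -(τ / (μ + ν + τ)), 0, τ * (μ + ν) / ((μ + ν + σ) * (μ + ν + σ + τ))]

def V₂₁ (μ ν σ τ : ℝ) : Matrix (Fin 3) (Fin 4) ℝ :=
  !![μ / (μ + σ), -(μ * σ / ((ν + σ) * (μ + ν + σ))), 0, 0;
     0, 0, μ / (μ + τ), -(μ * τ / ((ν + τ) * (μ + ν + τ)));
     0, 0, -(μ / (μ + σ + τ)), μ * (σ + τ) / ((ν + σ + τ) * (μ + ν + σ + τ))]

def V₂₂ (μ ν σ τ : ℝ) : Matrix (Fin 3) (Fin 4) ℝ :=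
  !![0, 0, ν / (ν + σ), -(ν * σ / ((μ + σ) * (μ + ν + σ)));
     ν / (ν + τ), -(ν * τ / ((μ + τ) * (μ + ν + τ))), 0, 0;
     0, 0, -(ν / (ν + σ + τ)), ν * (σ + τ) / ((μ + σ + τ) * (μ + ν + σ + τ))]

/-- The `8 × 8` matrix `W`, in `4 × 4` blocks. -/
def W (μ ν σ τ : ℝ) : Matrix (Fin 4 ⊕ Fin 4) (Fin 4 ⊕ Fin 4) ℝ :=
  Matrix.fromBlocks
    (U₁ μ ν τ * V₁₁ μ ν σ τ) (U₁ μ ν τ * V₁₂ μ ν σ τ)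
    (U₂ μ σ τ * V₂₁ μ ν σ τ) (U₂ μ σ τ * V₂₂ μ ν σ τ)

def q₁ (μ ν σ τ : ℝ) : Fin 4 → ℝ :=
  ![(μ ^ 2 + μ * σ + σ ^ 2) / (μ * σ * (μ + σ)),
    μ * σ * (μ + 2 * ν + σ) / (ν * (μ + ν) * (ν + σ) * (μ + ν + σ)),
    μ * σ * (μ + σ + 2 * τ) / (τ * (μ + τ) * (σ + τ) * (μ + σ + τ)),
    -(μ * σ * (μ + 2 * ν + 2 * τ + σ) /
      ((ν + τ) * (μ + ν + τ) * (ν + σ + τ) * (μ + ν + σ + τ)))]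

def q₂ (μ ν σ τ : ℝ) : Fin 4 → ℝ :=
  ![(ν ^ 2 + ν * τ + τ ^ 2) / (ν * τ * (ν + τ)),
    ν * τ * (2 * μ + ν + τ) / (μ * (μ + ν) * (μ + τ) * (μ + ν + τ)),
    ν * τ * (ν + 2 * σ + τ) / (σ * (ν + σ) * (σ + τ) * (ν + σ + τ)),
    -(ν * τ * (2 * μ + ν + 2 * σ + τ) /
      ((μ + σ) * (μ + ν + σ) * (μ + σ + τ) * (μ + ν + σ + τ)))]

/-- `ω = (ω₁, ω₂)`, with `ω₁ = (ω₁₀, …, ω₁₃)` and `ω₂ = (ω₂₀, …, ω₂₃)`, solves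
`(I - W) ω = 0`, `ω₁₀ + ω₂₀ = 1`. -/
def IsSolution (μ ν σ τ : ℝ) (ω : Fin 4 ⊕ Fin 4 → ℝ) : Prop :=
  (1 - W μ ν σ τ) *ᵥ ω = 0 ∧ ω (Sum.inl 0) + ω (Sum.inr 0) = 1

end

end MaxPlus

/-! By max-plus homogeneity the difference d(k) = y(k) - x(k) is a Markov chain on its own, and the
increment of max(x, y) depends only on d and the fresh matrix. For d ≤ 0 the law of max(α, β + d) is
the signed mixture Exp(μ) + e^{νd} (Exp(ν) - Exp(μ + ν)), so d enters only through the weight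
(`isExpMixture_max`). The same holds for the second row, and for d > 0 after swapping columns. Hence
the transition operator maps the span of the eight functions `expBasis` into itself, with matrix W
(`integral_expBasis_nextDiff`), and the mean increment of max(x, y) lies in that span with
coefficients q₁, q₂ (`integral_maxIncr`).

Uniqueness: two trajectories driven by the same noise merge within two steps with a probability
bounded below, so W² contracts oscillations (`exists_contraction`). A fixed vector of W with total
mass 0 is a functional bounded by the oscillation (`exists_bound_of_fixed`), hence zero
(`eq_zero_of_fixed`). Existence: constants are preserved, which gives a left eigenvector of W for
the eigenvalue 1.

Limit: uniqueness makes the Poisson equation c(1 - W) = q - (q·ω)e solvable (`exists_poisson`).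
Adding the bounded corrector c·`expBasis`(d) to max(x, y) and subtracting the drift k(q·ω) leaves a
process with centred increments of bounded second moment, so its second moment grows at most
linearly. Chebyshev-type summation along the squares gives convergence there, and monotonicity of
max(x(k), y(k)) fills the gaps. No stationary law is ever constructed. -/

namespace MaxPlus

noncomputable section

/-! ### Integrals against the exponential distribution -/

lemma expMeasure_eq_withDensity_Ioi (r : ℝ) :
    expMeasure r = (volume.restrict (Set.Ioi 0)).withDensity
      (fun x => ENNReal.ofReal (r * Real.exp (-(r * x)))) := by
  have h1 : expMeasure r = volume.withDensity (exponentialPDF r) := rfl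
  rw [h1, ← withDensity_indicator measurableSet_Ioi]
  apply withDensity_congr_ae
  have h0 : ∀ᵐ x : ℝ, x ≠ 0 := by simp [ae_iff]
  filter_upwards [h0] with x hx
  rw [exponentialPDF_eq]
  by_cases h : 0 < x
  · simp [h, h.le]
  · have : ¬ 0 ≤ x := fun h' => h (lt_of_le_of_ne h' (Ne.symm hx))
    simp [h, this]

lemma integral_expMeasure {r : ℝ} (hr : 0 < r) (φ : ℝ → ℝ) :
    ∫ x, φ x ∂expMeasure r = ∫ x in Set.Ioi 0, r * Real.exp (-(r * x)) * φ x := by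
  rw [expMeasure_eq_withDensity_Ioi,
    integral_withDensity_eq_integral_toReal_smul (by fun_prop) (by simp)]
  refine integral_congr_ae (Eventually.of_forall fun x => ?_)
  have : 0 ≤ r * Real.exp (-(r * x)) := by positivity
  simp [ENNReal.toReal_ofReal this]

lemma integrable_expMeasure_iff {r : ℝ} (hr : 0 < r) (φ : ℝ → ℝ) :
    Integrable φ (expMeasure r) ↔
      IntegrableOn (fun x => r * Real.exp (-(r * x)) * φ x) (Set.Ioi 0) := by
  rw [expMeasure_eq_withDensity_Ioi,
    integrable_withDensity_iff_integrable_smul' (by fun_prop) (by simp), IntegrableOn]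
  refine integrable_congr (Eventually.of_forall fun x => ?_)
  have : 0 ≤ r * Real.exp (-(r * x)) := by positivity
  simp [ENNReal.toReal_ofReal this]

lemma expMeasure_Iic {r : ℝ} (hr : 0 < r) (x : ℝ) :
    expMeasure r (Set.Iic x) =
      ENNReal.ofReal (if 0 ≤ x then 1 - Real.exp (-(r * x)) else 0) := by
  have := isProbabilityMeasure_expMeasure hr
  rw [← cdf_expMeasure_eq hr, ofReal_cdf]

lemma ae_pos_expMeasure {r : ℝ} (hr : 0 < r) : ∀ᵐ x ∂expMeasure r, 0 < x := by
  have h := expMeasure_Iic hr 0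
  simp only [le_refl, if_true, mul_zero, neg_zero, Real.exp_zero, sub_self,
    ENNReal.ofReal_zero] at h
  rw [ae_iff]
  convert h using 2
  ext x
  simp

lemma integrable_pow_expMeasure {r : ℝ} (hr : 0 < r) (n : ℕ) :
    Integrable (fun x => x ^ n) (expMeasure r) := by
  rw [integrable_expMeasure_iff hr]
  have h := integrableOn_rpow_mul_exp_neg_mul_rpow (p := 1) (s := n) (b := r)
    (by have : (0 : ℝ) ≤ n := by positivity
        linarith) one_pos hr
  refine (h.const_mul r).congr (Eventually.of_forall fun x => ?_)
  simp only [Real.rpow_natCast, Real.rpow_one, neg_mul]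
  ring

lemma integrable_id_expMeasure {r : ℝ} (hr : 0 < r) :
    Integrable (fun x => x) (expMeasure r) := by
  simpa using integrable_pow_expMeasure hr 1

/-- Integral of an exponential over the part of the exponential distribution above `y`. -/
lemma integral_Ioi_exp_expMeasure {a r y : ℝ} (ha : 0 < a) (hr : 0 ≤ r) (hy : 0 ≤ y) :
    ∫ x, (if y < x then Real.exp (-(r * (x - y))) else 0) ∂expMeasure a =
      Real.exp (-(a * y)) * (a / (a + r)) := by
  rw [integral_expMeasure ha]
  have h1 : (fun x => a * Real.exp (-(a * x)) *
      (if y < x then Real.exp (-(r * (x - y))) else 0)) =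
      (Set.Ioi y).indicator (fun x => a * Real.exp (r * y) * Real.exp (-(a + r) * x)) := by
    ext x
    by_cases h : y < x
    · simp only [h, if_true, Set.mem_Ioi, Set.indicator_of_mem]
      rw [mul_assoc, mul_assoc, ← Real.exp_add, ← Real.exp_add]
      ring_nf
    · simp [h]
  rw [h1, setIntegral_indicator measurableSet_Ioi,
    Set.inter_eq_self_of_subset_right (Set.Ioi_subset_Ioi hy), integral_const_mul,
    integral_exp_mul_Ioi (by linarith)]
  have h2 : Real.exp (-(a + r) * y) = Real.exp (-(a * y)) * Real.exp (-(r * y)) := by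
    rw [← Real.exp_add]; ring_nf
  have h3 : Real.exp (r * y) * Real.exp (-(r * y)) = 1 := by
    rw [← Real.exp_add]; simp
  have : a + r ≠ 0 := by positivity
  rw [h2, neg_div_neg_eq]
  calc _ = a * (Real.exp (r * y) * Real.exp (-(r * y))) * Real.exp (-(a * y)) / (a + r) := by ring
    _ = _ := by rw [h3]; ring

lemma expMeasure_singleton (r y : ℝ) : expMeasure r {y} = 0 := by
  rw [expMeasure_eq_withDensity_Ioi]
  exact withDensity_absolutelyContinuous _ _ (by simp)

lemma integral_Ici_exp_expMeasure {a r y : ℝ} (ha : 0 < a) (hr : 0 ≤ r) (hy : 0 ≤ y) :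
    ∫ x, (if y ≤ x then Real.exp (-(r * (x - y))) else 0) ∂expMeasure a =
      Real.exp (-(a * y)) * (a / (a + r)) := by
  rw [← integral_Ioi_exp_expMeasure ha hr hy]
  apply integral_congr_ae
  have h0 : ∀ᵐ x ∂expMeasure a, x ≠ y := by simp [ae_iff, expMeasure_singleton]
  filter_upwards [h0] with x hx
  simp [le_iff_lt_or_eq, Ne.symm hx]

lemma integral_exp_expMeasure {a r : ℝ} (ha : 0 < a) (hr : 0 ≤ r) :
    ∫ x, Real.exp (-(r * x)) ∂expMeasure a = a / (a + r) := by
  have h := integral_Ioi_exp_expMeasure ha hr le_rfl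
  simp only [mul_zero, neg_zero, Real.exp_zero, one_mul, sub_zero] at h
  rw [← h]
  apply integral_congr_ae
  filter_upwards [ae_pos_expMeasure ha] with x hx
  simp [hx]

lemma integral_id_expMeasure {a : ℝ} (ha : 0 < a) : ∫ x, x ∂expMeasure a = 1 / a := by
  rw [integral_expMeasure ha]
  have h := Real.integral_rpow_mul_exp_neg_mul_Ioi (a := 2) (r := a) two_pos ha
  rw [show (2 : ℝ) - 1 = 1 by norm_num, Real.Gamma_two] at h
  calc _ = ∫ x in Set.Ioi 0, a * (x ^ (1 : ℝ) * Real.exp (-(a * x))) := by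
        simp only [Real.rpow_one]
        congr 1; ext x; ring
    _ = _ := by
        rw [integral_const_mul, h]
        norm_num
        field_simp

/-- Write max(x, y) = y + (x - y)⁺; the excess over y has mean e^{-ay}/a. -/
lemma integral_max_expMeasure {a y : ℝ} (ha : 0 < a) (hy : 0 ≤ y) :
    ∫ x, max x y ∂expMeasure a = y + Real.exp (-(a * y)) / a := by
  have := isProbabilityMeasure_expMeasure ha
  rw [integral_expMeasure ha]
  have h2 : ∫ x in Set.Ioi 0, a * Real.exp (-(a * x)) = 1 := by
    have := integral_expMeasure ha (fun _ => 1)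
    simpa using this.symm
  have hi : IntegrableOn (fun x => a * Real.exp (-(a * x)) * x) (Set.Ioi 0) :=
    (integrable_expMeasure_iff ha _).1 (integrable_id_expMeasure ha)
  have hi1 : IntegrableOn (fun x => a * Real.exp (-(a * x)) * 1) (Set.Ioi 0) :=
    (integrable_expMeasure_iff ha _).1 (integrable_const _)
  -- An antiderivative of the density times (x - y), found by integrating by parts.
  have hd : ∀ x, HasDerivAt (fun x => -((x - y) + 1 / a) * Real.exp (-(a * x)))
      (a * Real.exp (-(a * x)) * (x - y)) x := by
    intro x
    have h3 : HasDerivAt (fun x => Real.exp (-(a * x))) (Real.exp (-(a * x)) * (-(a * 1))) x :=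
      ((hasDerivAt_id x).const_mul a).neg.exp
    have h4 : HasDerivAt (fun x => -((x - y) + 1 / a)) (-1) x :=
      (((hasDerivAt_id x).sub_const y).add_const (1 / a)).neg
    convert! h4.mul h3 using 1
    field_simp
    ring
  have ht : Tendsto (fun x => -((x - y) + 1 / a) * Real.exp (-(a * x))) atTop (𝓝 0) := by
    have h5 := Real.tendsto_pow_mul_exp_neg_atTop_nhds_zero 1
    have h6 : Tendsto (fun x : ℝ => a * x) atTop atTop := tendsto_id.const_mul_atTop ha
    have h7 := h5.comp h6
    have h8 := (Real.tendsto_exp_neg_atTop_nhds_zero).comp h6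
    have h9 := (h7.const_mul (-(1 / a))).add (h8.const_mul (y - 1 / a))
    simp only [mul_zero, add_zero] at h9
    refine h9.congr fun x => ?_
    simp only [Function.comp, pow_one]
    field_simp
    ring
  have hint : IntegrableOn (fun x => a * Real.exp (-(a * x)) * (x - y)) (Set.Ioi 0) := by
    refine (hi.sub (hi1.const_mul y)).congr (Eventually.of_forall fun x => ?_)
    simp only [Pi.sub_apply]
    ring
  have h3 := integral_Ioi_of_hasDerivAt_of_tendsto' (a := y) (fun x _ => hd x)
    (hint.mono_set (Set.Ioi_subset_Ioi hy)) ht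
  have h4 : (fun x => a * Real.exp (-(a * x)) * max x y) = fun x =>
      a * Real.exp (-(a * x)) * 1 * y +
        (Set.Ioi y).indicator (fun x => a * Real.exp (-(a * x)) * (x - y)) x := by
    ext x
    by_cases h : y < x
    · simp only [h.le, max_eq_left, Set.mem_Ioi, h, Set.indicator_of_mem]
      ring
    · simp [h, not_lt.1 h]
  rw [h4, integral_add (hi1.mul_const y) (hint.indicator measurableSet_Ioi), integral_mul_const,
    setIntegral_indicator measurableSet_Ioi,
    Set.inter_eq_self_of_subset_right (Set.Ioi_subset_Ioi hy), h3]
  simp only [mul_one, h2]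
  ring

/-! ### Signed mixtures of three exponential distributions -/

/-- `m` is the signed mixture `Exp(a) + u (Exp(b) - Exp(a + b))` of exponential distributions. -/
def IsExpMixture (m : Measure ℝ) (a b u : ℝ) : Prop :=
  m + ENNReal.ofReal u • expMeasure (a + b) = expMeasure a + ENNReal.ofReal u • expMeasure b

/-- For t ≥ 0 the distribution function is (1 - e^{-at})(1 - u e^{-bt}) with u = e^{-bd}; expanding
gives weights 1, u, -u on the rates a, b, a + b. For t < 0 everything vanishes. Moving the negative
term across keeps both sides honest measures, determined by their values on half lines. -/
lemma isExpMixture_max {a b d : ℝ} (ha : 0 < a) (hb : 0 < b) (hd : 0 ≤ d) :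
    IsExpMixture (((expMeasure a).prod (expMeasure b)).map (fun p => max p.1 (p.2 - d)))
      a b (Real.exp (-(b * d))) := by
  have := isProbabilityMeasure_expMeasure ha
  have := isProbabilityMeasure_expMeasure hb
  have := isProbabilityMeasure_expMeasure (add_pos ha hb)
  have hm : Measurable (fun p : ℝ × ℝ => max p.1 (p.2 - d)) := by fun_prop
  have := Measure.isProbabilityMeasure_map (μ := (expMeasure a).prod (expMeasure b)) hm.aemeasurable
  unfold IsExpMixture
  have f1 : ∀ u : ℝ, IsFiniteMeasure (ENNReal.ofReal u • expMeasure (a + b)) :=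
    fun u => Measure.smul_finite _ ENNReal.ofReal_ne_top
  have f2 : ∀ u : ℝ, IsFiniteMeasure (ENNReal.ofReal u • expMeasure b) :=
    fun u => Measure.smul_finite _ ENNReal.ofReal_ne_top
  refine Measure.ext_of_Iic _ _ fun t => ?_
  simp only [Measure.add_apply, Measure.smul_apply, smul_eq_mul]
  rw [Measure.map_apply hm measurableSet_Iic]
  have hpre : (fun p : ℝ × ℝ => max p.1 (p.2 - d)) ⁻¹' Set.Iic t =
      Set.Iic t ×ˢ Set.Iic (t + d) := by
    ext p
    simp only [Set.mem_preimage, Set.mem_Iic, max_le_iff, Set.mem_prod, sub_le_iff_le_add]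
  rw [hpre, Measure.prod_prod, expMeasure_Iic ha, expMeasure_Iic hb, expMeasure_Iic hb,
    expMeasure_Iic (add_pos ha hb)]
  by_cases ht : 0 ≤ t
  · have htd : 0 ≤ t + d := by positivity
    simp only [ht, htd, if_true]
    have e1 : ∀ {c s : ℝ}, 0 < c → 0 ≤ s → 0 ≤ 1 - Real.exp (-(c * s)) := fun hc hs => by
      rw [sub_nonneg, Real.exp_le_one_iff, neg_nonpos]
      positivity
    rw [← ENNReal.ofReal_mul (e1 ha ht), ← ENNReal.ofReal_mul (Real.exp_nonneg _),
      ← ENNReal.ofReal_mul (Real.exp_nonneg _),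
      ← ENNReal.ofReal_add (mul_nonneg (e1 ha ht) (e1 hb htd))
        (mul_nonneg (Real.exp_nonneg _) (e1 (add_pos ha hb) ht)),
      ← ENNReal.ofReal_add (e1 ha ht) (mul_nonneg (Real.exp_nonneg _) (e1 hb ht))]
    congr 1
    have h1 : Real.exp (-((a + b) * t)) = Real.exp (-(a * t)) * Real.exp (-(b * t)) := by
      rw [← Real.exp_add]; ring_nf
    have h2 : Real.exp (-(b * (t + d))) = Real.exp (-(b * t)) * Real.exp (-(b * d)) := by
      rw [← Real.exp_add]; ring_nf
    rw [h1, h2]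
    ring
  · simp [ht]

lemma isExpMixture_max_swap {a b d : ℝ} (ha : 0 < a) (hb : 0 < b) (hd : 0 ≤ d) :
    IsExpMixture (((expMeasure b).prod (expMeasure a)).map (fun p => max (p.1 - d) p.2))
      a b (Real.exp (-(b * d))) := by
  have := isProbabilityMeasure_expMeasure ha
  have := isProbabilityMeasure_expMeasure hb
  have h := isExpMixture_max ha hb hd
  rw [← Measure.prod_swap, Measure.map_map (by fun_prop) (by fun_prop)] at h
  convert! h using 2
  ext p
  simp [max_comm]

lemma integrable_expMeasure_of_growth {r C : ℝ} (hr : 0 < r) {φ : ℝ → ℝ} (hφ : Measurable φ)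
    (hb : ∀ x, |φ x| ≤ C + |x|) : Integrable φ (expMeasure r) := by
  have := isProbabilityMeasure_expMeasure hr
  refine Integrable.mono' ((integrable_const C).add (integrable_id_expMeasure hr).abs)
    hφ.aestronglyMeasurable (Eventually.of_forall fun x => ?_)
  simpa using hb x

namespace IsExpMixture

variable {m m' : Measure ℝ} {a b u a' b' u' : ℝ}

/-- The defining identity makes m a summand of a positive combination of two exponential laws. -/
lemma integrable (h : IsExpMixture m a b u) {φ : ℝ → ℝ} (h1 : Integrable φ (expMeasure a))
    (h2 : Integrable φ (expMeasure b)) : Integrable φ m := by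
  have h4 : Integrable φ (expMeasure a + ENNReal.ofReal u • expMeasure b) :=
    h1.add_measure (h2.smul_measure ENNReal.ofReal_ne_top)
  rw [← h] at h4
  exact h4.left_of_add_measure

lemma integral_eq (h : IsExpMixture m a b u) (hu : 0 ≤ u) {φ : ℝ → ℝ}
    (h1 : Integrable φ (expMeasure a))
    (h2 : Integrable φ (expMeasure b)) (h3 : Integrable φ (expMeasure (a + b))) :
    ∫ x, φ x ∂m = ∫ x, φ x ∂expMeasure a +
      u * (∫ x, φ x ∂expMeasure b - ∫ x, φ x ∂expMeasure (a + b)) := by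
  have hm := h.integrable h1 h2
  have h5 := congrArg (fun M => ∫ x, φ x ∂M) h
  rw [integral_add_measure hm (h3.smul_measure ENNReal.ofReal_ne_top),
    integral_add_measure h1 (h2.smul_measure ENNReal.ofReal_ne_top), integral_smul_measure,
    integral_smul_measure, ENNReal.toReal_ofReal hu, smul_eq_mul, smul_eq_mul] at h5
  linarith

/-- The integral against a product of two mixtures, in terms of the values `B` of the integral
against products of exponential distributions. -/
lemma integral_prod_eq [IsProbabilityMeasure m] [IsProbabilityMeasure m']
    (h : IsExpMixture m a b u) (h' : IsExpMixture m' a' b' u')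
    (ha : 0 < a) (hb : 0 < b) (hu : 0 ≤ u) (ha' : 0 < a') (hb' : 0 < b') (hu' : 0 ≤ u')
    {Φ : ℝ → ℝ → ℝ} (hΦ : Measurable (Function.uncurry Φ))
    (hgr : ∀ x y, |Φ x y| ≤ 1 + |x| + |y|) {B : ℝ → ℝ → ℝ}
    (hB : ∀ r s, 0 < r → 0 < s → ∫ y, ∫ x, Φ x y ∂expMeasure r ∂expMeasure s = B r s) :
    Integrable (Function.uncurry Φ) (m.prod m') ∧
    ∫ p, Φ p.1 p.2 ∂(m.prod m') =
      (B a a' + u' * (B a b' - B a (a' + b'))) +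
        u * ((B b a' + u' * (B b b' - B b (a' + b'))) -
          (B (a + b) a' + u' * (B (a + b) b' - B (a + b) (a' + b')))) := by
  have hab := add_pos ha hb
  have hab' := add_pos ha' hb'
  have hx : ∀ y, Measurable fun x => Φ x y := fun y =>
    hΦ.comp (measurable_id.prodMk measurable_const)
  have hI : ∀ {r : ℝ}, 0 < r → ∀ y, Integrable (fun x => Φ x y) (expMeasure r) := fun hr y =>
    integrable_expMeasure_of_growth (C := 1 + |y|) hr (hx y) fun x => by
      linarith [hgr x y]
  have hGm : ∀ {r : ℝ}, 0 < r → Measurable fun y => ∫ x, Φ x y ∂expMeasure r := fun {r} hr => by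
    have := isProbabilityMeasure_expMeasure hr
    exact (StronglyMeasurable.integral_prod_left (f := Φ) hΦ.stronglyMeasurable).measurable
  have hG : ∀ {r s : ℝ}, 0 < r → 0 < s →
      Integrable (fun y => ∫ x, Φ x y ∂expMeasure r) (expMeasure s) := fun {r s} hr hs => by
    have := isProbabilityMeasure_expMeasure hr
    refine integrable_expMeasure_of_growth (C := 1 + ∫ x, |x| ∂expMeasure r) hs (hGm hr)
      fun y => ?_
    have hi := (integrable_id_expMeasure hr).abs
    calc |∫ x, Φ x y ∂expMeasure r| ≤ ∫ x, |Φ x y| ∂expMeasure r := abs_integral_le_integral_abs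
      _ ≤ ∫ x, (1 + |y|) + |x| ∂expMeasure r := by
          refine integral_mono (hI hr y).abs ((integrable_const _).add hi) fun x => ?_
          have := hgr x y
          simp only
          linarith
      _ = _ := by
          rw [integral_add (integrable_const _) hi]
          simp
          ring
  have hid : Integrable (fun x => |x|) m :=
    h.integrable (integrable_id_expMeasure ha).abs (integrable_id_expMeasure hb).abs
  have hid' : Integrable (fun x => |x|) m' :=
    h'.integrable (integrable_id_expMeasure ha').abs (integrable_id_expMeasure hb').abs
  have hint : Integrable (Function.uncurry Φ) (m.prod m') := by
    refine Integrable.mono' (((integrable_const 1).add (hid.comp_fst m')).add (hid'.comp_snd m))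
      hΦ.aestronglyMeasurable (Eventually.of_forall fun p => ?_)
    simpa [Function.uncurry] using hgr p.1 p.2
  refine ⟨hint, ?_⟩
  rw [integral_prod_symm (fun p => Φ p.1 p.2) hint]
  simp only
  have hin : ∀ y, ∫ x, Φ x y ∂m = ∫ x, Φ x y ∂expMeasure a +
      u * (∫ x, Φ x y ∂expMeasure b - ∫ x, Φ x y ∂expMeasure (a + b)) := fun y =>
    h.integral_eq hu (hI ha y) (hI hb y) (hI hab y)
  simp_rw [hin]
  have hGm' : ∀ {r : ℝ}, 0 < r → Integrable (fun y => ∫ x, Φ x y ∂expMeasure r) m' :=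
    fun hr => h'.integrable (hG hr ha') (hG hr hb')
  have hout : ∀ {r : ℝ}, 0 < r → ∫ y, ∫ x, Φ x y ∂expMeasure r ∂m' =
      B r a' + u' * (B r b' - B r (a' + b')) := fun {r} hr => by
    rw [h'.integral_eq hu' (hG hr ha') (hG hr hb') (hG hr hab'), hB r _ hr ha', hB r _ hr hb',
      hB r _ hr hab']
  have hsub : Integrable (fun y => u * (∫ x, Φ x y ∂expMeasure b -
      ∫ x, Φ x y ∂expMeasure (a + b))) m' := ((hGm' hb).sub (hGm' hab)).const_mul u
  rw [integral_add (hGm' ha) hsub, integral_const_mul,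
    integral_sub (hGm' hb) (hGm' hab), hout ha, hout hb, hout hab]

end IsExpMixture

/-! ### Integrals of the basic functions of two exponential variables -/

/-- Lack of memory: x ≥ y has probability b/(a + b), and then x - y is again Exp(a), with Laplace
transform a/(a + r). This product form is the source of the factorization of the blocks of W as U
times V. -/
lemma integral_integral_ge {a b r : ℝ} (ha : 0 < a) (hb : 0 < b) (hr : 0 ≤ r) :
    ∫ y, ∫ x, (if y ≤ x then Real.exp (-(r * (x - y))) else 0) ∂expMeasure a ∂expMeasure b =
      b / (a + b) * (a / (a + r)) := by
  have h : ∀ᵐ y ∂expMeasure b,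
      ∫ x, (if y ≤ x then Real.exp (-(r * (x - y))) else 0) ∂expMeasure a =
        Real.exp (-(a * y)) * (a / (a + r)) := by
    filter_upwards [ae_pos_expMeasure hb] with y hy
    exact integral_Ici_exp_expMeasure ha hr hy.le
  rw [integral_congr_ae h, integral_mul_const, integral_exp_expMeasure hb ha.le, add_comm b a]

lemma measurable_uncurry_ge (r : ℝ) : Measurable (Function.uncurry fun x y : ℝ =>
    if y ≤ x then Real.exp (-(r * (x - y))) else 0) :=
  Measurable.ite (measurableSet_le measurable_snd measurable_fst) (by fun_prop) (by fun_prop)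

lemma measurable_uncurry_lt (r : ℝ) : Measurable (Function.uncurry fun x y : ℝ =>
    if x < y then Real.exp (-(r * (y - x))) else 0) :=
  Measurable.ite (measurableSet_lt measurable_fst measurable_snd) (by fun_prop) (by fun_prop)

lemma abs_ite_exp_le_one {p : Prop} [Decidable p] {t : ℝ} (h : p → 0 ≤ t) :
    |if p then Real.exp (-t) else 0| ≤ 1 := by
  split_ifs with hp
  · rw [abs_of_pos (Real.exp_pos _), Real.exp_le_one_iff]
    linarith [h hp]
  · simp

lemma integral_integral_lt {a b r : ℝ} (ha : 0 < a) (hb : 0 < b) (hr : 0 ≤ r) :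
    ∫ y, ∫ x, (if x < y then Real.exp (-(r * (y - x))) else 0) ∂expMeasure a ∂expMeasure b =
      a / (a + b) * (b / (b + r)) := by
  have := isProbabilityMeasure_expMeasure ha
  have := isProbabilityMeasure_expMeasure hb
  -- The larger variable must be integrated first for lack of memory to apply.
  rw [integral_integral_swap]
  · have h : ∀ᵐ x ∂expMeasure a,
        ∫ y, (if x < y then Real.exp (-(r * (y - x))) else 0) ∂expMeasure b =
          Real.exp (-(b * x)) * (b / (b + r)) := by
      filter_upwards [ae_pos_expMeasure ha] with x hx
      exact integral_Ioi_exp_expMeasure hb hr hx.le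
    rw [integral_congr_ae h, integral_mul_const, integral_exp_expMeasure ha hb.le]
  · refine Integrable.mono' (integrable_const 1)
      ((measurable_uncurry_lt r).comp measurable_swap).aestronglyMeasurable
      (Eventually.of_forall fun p => ?_)
    exact abs_ite_exp_le_one fun h => mul_nonneg hr (sub_nonneg.2 h.le)

lemma integral_integral_max {a b : ℝ} (ha : 0 < a) (hb : 0 < b) :
    ∫ y, ∫ x, max x y ∂expMeasure a ∂expMeasure b = 1 / a + 1 / b - 1 / (a + b) := by
  have := isProbabilityMeasure_expMeasure hb
  have h : ∀ᵐ y ∂expMeasure b, ∫ x, max x y ∂expMeasure a = y + Real.exp (-(a * y)) / a := by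
    filter_upwards [ae_pos_expMeasure hb] with y hy
    exact integral_max_expMeasure ha hy.le
  have hi : Integrable (fun y => Real.exp (-(a * y))) (expMeasure b) := by
    refine Integrable.mono' (integrable_const 1)
      (by fun_prop) ?_
    filter_upwards [ae_pos_expMeasure hb] with y hy
    rw [Real.norm_of_nonneg (Real.exp_nonneg _), Real.exp_le_one_iff, neg_nonpos]
    positivity
  rw [integral_congr_ae h, integral_add (integrable_id_expMeasure hb) (hi.div_const a),
    integral_id_expMeasure hb, integral_div, integral_exp_expMeasure hb ha.le]
  have : a + b ≠ 0 := by positivity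
  have : b + a ≠ 0 := by positivity
  field_simp
  ring

/-! ### One step of the system -/

/-- The law of the entries `((α, β), (γ, δ))` of one matrix. -/
def noiseLaw (μ ν σ τ : ℝ) : Measure ((ℝ × ℝ) × (ℝ × ℝ)) :=
  ((expMeasure μ).prod (expMeasure ν)).prod ((expMeasure σ).prod (expMeasure τ))

lemma isProbabilityMeasure_noiseLaw {μ ν σ τ : ℝ} (hμ : 0 < μ) (hν : 0 < ν) (hσ : 0 < σ)
    (hτ : 0 < τ) : IsProbabilityMeasure (noiseLaw μ ν σ τ) := by
  have := isProbabilityMeasure_expMeasure hμ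
  have := isProbabilityMeasure_expMeasure hν
  have := isProbabilityMeasure_expMeasure hσ
  have := isProbabilityMeasure_expMeasure hτ
  unfold noiseLaw
  infer_instance

/-- The matrix with entries `((α, β), (γ, δ))`. -/
def noiseMatrix (a : (ℝ × ℝ) × (ℝ × ℝ)) : Matrix (Fin 2) (Fin 2) ℝ :=
  !![a.1.1, a.1.2; a.2.1, a.2.2]

/-- The next value of `y - x` when the present one is `d`. -/
def nextDiff (d : ℝ) (a : (ℝ × ℝ) × (ℝ × ℝ)) : ℝ :=
  max a.2.1 (a.2.2 + d) - max a.1.1 (a.1.2 + d)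

/-- The increment of `max x y` when the present value of `y - x` is `d`. -/
def maxIncr (d : ℝ) (a : (ℝ × ℝ) × (ℝ × ℝ)) : ℝ :=
  max (max a.1.1 (a.1.2 + d)) (max a.2.1 (a.2.2 + d)) - max 0 d

/-- Factoring `z 0` out of both maxima cancels it, so the difference evolves autonomously. -/
lemma mulVec_diff (a : (ℝ × ℝ) × (ℝ × ℝ)) (z : Fin 2 → ℝ) :
    mulVec (noiseMatrix a) z 1 - mulVec (noiseMatrix a) z 0 = nextDiff (z 1 - z 0) a := by
  have h : ∀ s t : ℝ, max (z 0 + s) (z 1 + t) = z 0 + max s (t + (z 1 - z 0)) := fun s t => by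
    rw [← max_add_add_left]
    congr 1
    ring
  simp only [mulVec, noiseMatrix, nextDiff, Matrix.of_apply, Matrix.cons_val', Matrix.cons_val_zero,
    Matrix.cons_val_one, Matrix.cons_val_fin_one, h]
  ring

lemma mulVec_max (a : (ℝ × ℝ) × (ℝ × ℝ)) (z : Fin 2 → ℝ) :
    max (mulVec (noiseMatrix a) z 0) (mulVec (noiseMatrix a) z 1) =
      max (z 0) (z 1) + maxIncr (z 1 - z 0) a := by
  have h : ∀ s t : ℝ, max (z 0 + s) (z 1 + t) = z 0 + max s (t + (z 1 - z 0)) := fun s t => by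
    rw [← max_add_add_left]
    congr 1
    ring
  have h0 : max (z 0) (z 1) = z 0 + max 0 (z 1 - z 0) := by
    rw [← max_add_add_left]
    congr 1 <;> ring
  simp only [mulVec, noiseMatrix, maxIncr, Matrix.of_apply, Matrix.cons_val', Matrix.cons_val_zero,
    Matrix.cons_val_one, Matrix.cons_val_fin_one, h, h0, max_add_add_left]
  ring

/-- The exponents of the basis functions on the half line `d ≤ 0`. -/
def rate₁ (ν τ : ℝ) : Fin 4 → ℝ := ![0, ν, τ, ν + τ]

/-- The exponents of the basis functions on the half line `0 < d`. -/
def rate₂ (μ σ : ℝ) : Fin 4 → ℝ := ![0, μ, σ, μ + σ]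

/-- The vector of exponential functions of `d = y - x` whose span is preserved by the transition
operator of the Markov chain `y(k) - x(k)`. -/
def expBasis (μ ν σ τ d : ℝ) : Fin 4 ⊕ Fin 4 → ℝ :=
  Sum.elim (fun i => if d ≤ 0 then Real.exp (rate₁ ν τ i * d) else 0)
    (fun i => if 0 < d then Real.exp (-(rate₂ μ σ i * d)) else 0)

lemma rate₁_nonneg {ν τ : ℝ} (hν : 0 < ν) (hτ : 0 < τ) (i : Fin 4) : 0 ≤ rate₁ ν τ i := by
  fin_cases i <;> simp [rate₁] <;> positivity

lemma rate₂_nonneg {μ σ : ℝ} (hμ : 0 < μ) (hσ : 0 < σ) (i : Fin 4) : 0 ≤ rate₂ μ σ i := by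
  fin_cases i <;> simp [rate₂] <;> positivity

/-- For d > 0 the state is measured from y instead of x: the common shift d drops out, and the
remaining shift is a subtraction of a nonnegative number, as the mixture lemma requires. -/
lemma max_add_eq_max_sub_add (s t d : ℝ) : max s (t + d) = max (s - d) t + d := by
  rw [← max_add_add_right, sub_add_cancel]

lemma expBasis_inl_sub (μ ν σ τ x y : ℝ) (i : Fin 4) : expBasis μ ν σ τ (y - x) (Sum.inl i) =
    if y ≤ x then Real.exp (-(rate₁ ν τ i * (x - y))) else 0 := by
  simp only [expBasis, Sum.elim_inl, sub_nonpos]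
  congr 2
  ring

lemma expBasis_inr_sub (μ ν σ τ x y : ℝ) (i : Fin 4) : expBasis μ ν σ τ (y - x) (Sum.inr i) =
    if x < y then Real.exp (-(rate₂ μ σ i * (y - x))) else 0 := by
  simp only [expBasis, Sum.elim_inr, sub_pos]

section Integrals

variable {μ ν σ τ : ℝ} (hμ : 0 < μ) (hν : 0 < ν) (hσ : 0 < σ) (hτ : 0 < τ)
include hμ hν hσ hτ

/-- Integral of a function of the next state, started from `d ≤ 0`. -/
lemma integral_noiseLaw_of_nonpos {d : ℝ} (hd : d ≤ 0)
    {Φ : ℝ → ℝ → ℝ} (hΦ : Measurable (Function.uncurry Φ))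
    (hgr : ∀ x y, |Φ x y| ≤ 1 + |x| + |y|) {B : ℝ → ℝ → ℝ}
    (hB : ∀ r s, 0 < r → 0 < s → ∫ y, ∫ x, Φ x y ∂expMeasure r ∂expMeasure s = B r s) :
    Integrable (fun a : (ℝ × ℝ) × (ℝ × ℝ) => Φ (max a.1.1 (a.1.2 + d)) (max a.2.1 (a.2.2 + d)))
      (noiseLaw μ ν σ τ) ∧
    ∫ a, Φ (max a.1.1 (a.1.2 + d)) (max a.2.1 (a.2.2 + d)) ∂noiseLaw μ ν σ τ =
      (B μ σ + Real.exp (τ * d) * (B μ τ - B μ (σ + τ))) +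
        Real.exp (ν * d) * ((B ν σ + Real.exp (τ * d) * (B ν τ - B ν (σ + τ))) -
          (B (μ + ν) σ + Real.exp (τ * d) * (B (μ + ν) τ - B (μ + ν) (σ + τ)))) := by
  have := isProbabilityMeasure_expMeasure hμ
  have := isProbabilityMeasure_expMeasure hν
  have := isProbabilityMeasure_expMeasure hσ
  have := isProbabilityMeasure_expMeasure hτ
  have hd' : 0 ≤ -d := by linarith
  have hg : Measurable fun p : ℝ × ℝ => max p.1 (p.2 - -d) := by fun_prop
  have p1 := Measure.isProbabilityMeasure_map (μ := (expMeasure μ).prod (expMeasure ν))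
    hg.aemeasurable
  have p2 := Measure.isProbabilityMeasure_map (μ := (expMeasure σ).prod (expMeasure τ))
    hg.aemeasurable
  obtain ⟨h1, h2⟩ := (isExpMixture_max hμ hν hd').integral_prod_eq (isExpMixture_max hσ hτ hd')
    hμ hν (Real.exp_nonneg _) hσ hτ (Real.exp_nonneg _) hΦ hgr hB
  rw [Measure.map_prod_map _ _ hg hg] at h1 h2
  change ∫ p, Function.uncurry Φ p ∂_ = _ at h2
  rw [integral_map (hg.prodMap hg).aemeasurable hΦ.aestronglyMeasurable] at h2
  rw [integrable_map_measure hΦ.aestronglyMeasurable (hg.prodMap hg).aemeasurable] at h1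
  simp only [sub_neg_eq_add, mul_neg, neg_neg, Prod.map] at h1 h2
  exact ⟨h1, h2⟩

/-- Integral of a function of the next state, started from `d ≥ 0`. -/
lemma integral_noiseLaw_of_nonneg {d : ℝ} (hd : 0 ≤ d)
    {Φ : ℝ → ℝ → ℝ} (hΦ : Measurable (Function.uncurry Φ))
    (hgr : ∀ x y, |Φ x y| ≤ 1 + |x| + |y|) {B : ℝ → ℝ → ℝ}
    (hB : ∀ r s, 0 < r → 0 < s → ∫ y, ∫ x, Φ x y ∂expMeasure r ∂expMeasure s = B r s) :
    Integrable (fun a : (ℝ × ℝ) × (ℝ × ℝ) => Φ (max (a.1.1 - d) a.1.2) (max (a.2.1 - d) a.2.2))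
      (noiseLaw μ ν σ τ) ∧
    ∫ a, Φ (max (a.1.1 - d) a.1.2) (max (a.2.1 - d) a.2.2) ∂noiseLaw μ ν σ τ =
      (B ν τ + Real.exp (-(σ * d)) * (B ν σ - B ν (τ + σ))) +
        Real.exp (-(μ * d)) * ((B μ τ + Real.exp (-(σ * d)) * (B μ σ - B μ (τ + σ))) -
          (B (ν + μ) τ + Real.exp (-(σ * d)) * (B (ν + μ) σ - B (ν + μ) (τ + σ)))) := by
  have := isProbabilityMeasure_expMeasure hμ
  have := isProbabilityMeasure_expMeasure hν
  have := isProbabilityMeasure_expMeasure hσ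
  have := isProbabilityMeasure_expMeasure hτ
  have hg : Measurable fun p : ℝ × ℝ => max (p.1 - d) p.2 := by fun_prop
  have p1 := Measure.isProbabilityMeasure_map (μ := (expMeasure μ).prod (expMeasure ν))
    hg.aemeasurable
  have p2 := Measure.isProbabilityMeasure_map (μ := (expMeasure σ).prod (expMeasure τ))
    hg.aemeasurable
  -- The unshifted entries are now β and δ, so ν and τ lead and the weights carry μ and σ.
  obtain ⟨h1, h2⟩ := (isExpMixture_max_swap hν hμ hd).integral_prod_eq
    (isExpMixture_max_swap hτ hσ hd)
    hν hμ (Real.exp_nonneg _) hτ hσ (Real.exp_nonneg _) hΦ hgr hB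
  rw [Measure.map_prod_map _ _ hg hg] at h1 h2
  change ∫ p, Function.uncurry Φ p ∂_ = _ at h2
  rw [integral_map (hg.prodMap hg).aemeasurable hΦ.aestronglyMeasurable] at h2
  rw [integrable_map_measure hΦ.aestronglyMeasurable (hg.prodMap hg).aemeasurable] at h1
  exact ⟨h1, h2⟩

end Integrals

/-! ### The action of the transition operator on the basis functions -/

/-- The mean of `s / (r + s)`, with `s` distributed as the rate in the mixture of `s₁`, `s₂`,
`s₁ + s₂` with weights `1`, `v`, `-v`. -/
def mixRatio (r s₁ s₂ v : ℝ) : ℝ :=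
  s₁ / (r + s₁) + v * (s₂ / (r + s₂) - (s₁ + s₂) / (r + (s₁ + s₂)))

lemma mixRatio_eq {r s₁ s₂ : ℝ} (v : ℝ) (hr : 0 < r) (h₁ : 0 < s₁) (h₂ : 0 < s₂) :
    mixRatio r s₁ s₂ v = s₁ / (r + s₁) - v * (r * s₁ / ((r + s₂) * (r + s₁ + s₂))) := by
  have : r + s₁ ≠ 0 := by positivity
  have : r + s₂ ≠ 0 := by positivity
  have : r + (s₁ + s₂) ≠ 0 := by positivity
  have : r + s₁ + s₂ ≠ 0 := by positivity
  unfold mixRatio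
  field_simp
  ring

section Algebra

variable {μ ν σ τ : ℝ} (hμ : 0 < μ) (hν : 0 < ν) (hσ : 0 < σ) (hτ : 0 < τ)
include hμ hν hσ hτ

/-- The rows belong to the rates μ, ν, μ + ν of the new x, with mixture weights 1, u, -u; each
`mixRatio` averages the probability that the new y does not exceed x. In `V₂₁` and `V₂₂` the roles
of x and y are exchanged. -/
lemma V₁₁_mulVec (u v : ℝ) : V₁₁ μ ν σ τ *ᵥ ![1, u, v, u * v] =
    ![mixRatio μ σ τ v, u * mixRatio ν σ τ v, -(u * mixRatio (μ + ν) σ τ v)] := by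
  rw [mixRatio_eq v hμ hσ hτ, mixRatio_eq v hν hσ hτ, mixRatio_eq v (add_pos hμ hν) hσ hτ]
  ext i
  fin_cases i <;> simp [V₁₁, Matrix.mulVec, dotProduct, Fin.sum_univ_four] <;> ring

lemma V₁₂_mulVec (u v : ℝ) : V₁₂ μ ν σ τ *ᵥ ![1, u, v, u * v] =
    ![u * mixRatio μ τ σ v, mixRatio ν τ σ v, -(u * mixRatio (μ + ν) τ σ v)] := by
  rw [mixRatio_eq v hμ hτ hσ, mixRatio_eq v hν hτ hσ, mixRatio_eq v (add_pos hμ hν) hτ hσ]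
  ext i
  fin_cases i <;> simp [V₁₂, Matrix.mulVec, dotProduct, Fin.sum_univ_four] <;> ring

lemma V₂₁_mulVec (u v : ℝ) : V₂₁ μ ν σ τ *ᵥ ![1, u, v, u * v] =
    ![mixRatio σ μ ν u, v * mixRatio τ μ ν u, -(v * mixRatio (σ + τ) μ ν u)] := by
  rw [mixRatio_eq u hσ hμ hν, mixRatio_eq u hτ hμ hν, mixRatio_eq u (add_pos hσ hτ) hμ hν]
  ext i
  fin_cases i <;> simp [V₂₁, Matrix.mulVec, dotProduct, Fin.sum_univ_four] <;> ring

lemma V₂₂_mulVec (u v : ℝ) : V₂₂ μ ν σ τ *ᵥ ![1, u, v, u * v] =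
    ![v * mixRatio σ ν μ u, mixRatio τ ν μ u, -(v * mixRatio (σ + τ) ν μ u)] := by
  rw [mixRatio_eq u hσ hν hμ, mixRatio_eq u hτ hν hμ, mixRatio_eq u (add_pos hσ hτ) hν hμ]
  ext i
  fin_cases i <;> simp [V₂₂, Matrix.mulVec, dotProduct, Fin.sum_univ_four] <;> ring

omit hσ hτ in
-- The columns are the Laplace transforms of Exp(μ), Exp(ν), Exp(μ + ν) at the four basis exponents;
-- the exponent 0 gives the row of ones.
lemma U₁_row (i : Fin 4) : U₁ μ ν τ i = ![μ / (μ + rate₁ ν τ i), ν / (ν + rate₁ ν τ i),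
    (μ + ν) / (μ + ν + rate₁ ν τ i)] := by
  have : μ + ν ≠ 0 := by positivity
  ext j
  fin_cases i <;> fin_cases j <;> simp [U₁, rate₁, hμ.ne', hν.ne', this] <;> ring_nf
  field_simp

omit hμ hν in
lemma U₂_row (i : Fin 4) : U₂ μ σ τ i = ![σ / (σ + rate₂ μ σ i), τ / (τ + rate₂ μ σ i),
    (σ + τ) / (σ + τ + rate₂ μ σ i)] := by
  have : σ + τ ≠ 0 := by positivity
  ext j
  fin_cases i <;> fin_cases j <;> simp [U₂, rate₂, hσ.ne', hτ.ne', this] <;> ring_nf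
  field_simp

end Algebra

lemma expBasis_inl_of_nonpos {μ ν σ τ d : ℝ} (hd : d ≤ 0) :
    (fun i => expBasis μ ν σ τ d (Sum.inl i)) =
      ![1, Real.exp (ν * d), Real.exp (τ * d), Real.exp (ν * d) * Real.exp (τ * d)] := by
  ext i
  rw [← Real.exp_add, ← add_mul]
  fin_cases i <;> simp [expBasis, rate₁, hd]

lemma expBasis_inr_of_nonpos {μ ν σ τ d : ℝ} (hd : d ≤ 0) :
    (fun i => expBasis μ ν σ τ d (Sum.inr i)) = 0 := by
  ext i
  simp [expBasis, hd.not_gt]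

lemma expBasis_inl_of_pos {μ ν σ τ d : ℝ} (hd : 0 < d) :
    (fun i => expBasis μ ν σ τ d (Sum.inl i)) = 0 := by
  ext i
  simp [expBasis, hd.not_ge]

lemma expBasis_inr_of_pos {μ ν σ τ d : ℝ} (hd : 0 < d) :
    (fun i => expBasis μ ν σ τ d (Sum.inr i)) =
      ![1, Real.exp (-(μ * d)), Real.exp (-(σ * d)),
        Real.exp (-(μ * d)) * Real.exp (-(σ * d))] := by
  ext i
  rw [← Real.exp_add, ← neg_add, ← add_mul]
  fin_cases i <;> simp [expBasis, rate₂, hd]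

lemma W_mulVec_inl (μ ν σ τ : ℝ) (x : Fin 4 ⊕ Fin 4 → ℝ) (i : Fin 4) :
    (W μ ν σ τ *ᵥ x) (Sum.inl i) = U₁ μ ν τ i ⬝ᵥ
      (V₁₁ μ ν σ τ *ᵥ (fun j => x (Sum.inl j)) + V₁₂ μ ν σ τ *ᵥ (fun j => x (Sum.inr j))) := by
  rw [W, Matrix.fromBlocks_mulVec]
  simp only [Sum.elim_inl, ← Matrix.mulVec_mulVec, ← Matrix.mulVec_add]
  rfl

lemma W_mulVec_inr (μ ν σ τ : ℝ) (x : Fin 4 ⊕ Fin 4 → ℝ) (i : Fin 4) :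
    (W μ ν σ τ *ᵥ x) (Sum.inr i) = U₂ μ σ τ i ⬝ᵥ
      (V₂₁ μ ν σ τ *ᵥ (fun j => x (Sum.inl j)) + V₂₂ μ ν σ τ *ᵥ (fun j => x (Sum.inr j))) := by
  rw [W, Matrix.fromBlocks_mulVec]
  simp only [Sum.elim_inr, ← Matrix.mulVec_mulVec, ← Matrix.mulVec_add]
  rfl

section Step

variable {μ ν σ τ : ℝ} (hμ : 0 < μ) (hν : 0 < ν) (hσ : 0 < σ) (hτ : 0 < τ)
include hμ hν hσ hτ

/-- The transition operator acts on the basis functions by the matrix `W`. -/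
lemma integral_expBasis_nextDiff (d : ℝ) (i : Fin 4 ⊕ Fin 4) :
    ∫ a, expBasis μ ν σ τ (nextDiff d a) i ∂noiseLaw μ ν σ τ =
      (W μ ν σ τ *ᵥ expBasis μ ν σ τ d) i := by
  have hbd : ∀ {p : Prop} [Decidable p] {t x y : ℝ}, (p → 0 ≤ t) →
      |if p then Real.exp (-t) else 0| ≤ 1 + |x| + |y| := fun {_ _ _ x y} h =>
    (abs_ite_exp_le_one h).trans (by linarith [abs_nonneg x, abs_nonneg y])
  rcases i with i | i
  · have hr := rate₁_nonneg hν hτ i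
    have hm := measurable_uncurry_ge (rate₁ ν τ i)
    have hg : ∀ x y : ℝ, |if y ≤ x then Real.exp (-(rate₁ ν τ i * (x - y))) else 0| ≤
      1 + |x| + |y| := fun x y => hbd fun h => mul_nonneg hr (sub_nonneg.2 h)
    have hB := fun r s (h1 : 0 < r) (h2 : 0 < s) => integral_integral_ge h1 h2 hr
    rw [W_mulVec_inl]
    rcases le_or_gt d 0 with hd | hd
    · have h := (integral_noiseLaw_of_nonpos hμ hν hσ hτ hd hm hg hB).2
      simp only [nextDiff, expBasis_inl_sub]
      rw [h, expBasis_inl_of_nonpos hd, expBasis_inr_of_nonpos hd, Matrix.mulVec_zero, add_zero,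
        V₁₁_mulVec hμ hν hσ hτ, U₁_row hμ hν]
      simp [dotProduct, Fin.sum_univ_three, mixRatio]
      ring
    · have h := (integral_noiseLaw_of_nonneg hμ hν hσ hτ hd.le hm hg hB).2
      simp only [nextDiff, max_add_eq_max_sub_add, add_sub_add_right_eq_sub,
        expBasis_inl_sub]
      rw [h, expBasis_inl_of_pos hd, expBasis_inr_of_pos hd, Matrix.mulVec_zero, zero_add,
        V₁₂_mulVec hμ hν hσ hτ, U₁_row hμ hν, add_comm ν μ]
      simp [dotProduct, Fin.sum_univ_three, mixRatio]
      ring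
  · have hr := rate₂_nonneg hμ hσ i
    have hm := measurable_uncurry_lt (rate₂ μ σ i)
    have hg : ∀ x y : ℝ, |if x < y then Real.exp (-(rate₂ μ σ i * (y - x))) else 0| ≤
      1 + |x| + |y| := fun x y => hbd fun h => mul_nonneg hr (sub_nonneg.2 h.le)
    have hB := fun r s (h1 : 0 < r) (h2 : 0 < s) => integral_integral_lt h1 h2 hr
    rw [W_mulVec_inr]
    rcases le_or_gt d 0 with hd | hd
    · have h := (integral_noiseLaw_of_nonpos hμ hν hσ hτ hd hm hg hB).2
      simp only [nextDiff, expBasis_inr_sub]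
      rw [h, expBasis_inl_of_nonpos hd, expBasis_inr_of_nonpos hd, Matrix.mulVec_zero, add_zero,
        V₂₁_mulVec hμ hν hσ hτ, U₂_row hσ hτ]
      simp [dotProduct, Fin.sum_univ_three, mixRatio]
      ring
    · have h := (integral_noiseLaw_of_nonneg hμ hν hσ hτ hd.le hm hg hB).2
      simp only [nextDiff, max_add_eq_max_sub_add, add_sub_add_right_eq_sub,
        expBasis_inr_sub]
      rw [h, expBasis_inl_of_pos hd, expBasis_inr_of_pos hd, Matrix.mulVec_zero, zero_add,
        V₂₂_mulVec hμ hν hσ hτ, U₂_row hσ hτ, add_comm τ σ]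
      simp [dotProduct, Fin.sum_univ_three, mixRatio]
      ring

/-- The right side is the double mixture of the means 1/r + 1/s - 1/(r + s) of a maximum. Collecting
powers of u and v, and splitting each entry of q₁ into partial fractions, matches the two. -/
lemma q₁_dotProduct (u v : ℝ) : q₁ μ ν σ τ ⬝ᵥ ![1, u, v, u * v] =
    (1 / μ + 1 / σ - 1 / (μ + σ) + v * (1 / μ + 1 / τ - 1 / (μ + τ) -
        (1 / μ + 1 / (σ + τ) - 1 / (μ + (σ + τ))))) +
      u * (1 / ν + 1 / σ - 1 / (ν + σ) + v * (1 / ν + 1 / τ - 1 / (ν + τ) -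
        (1 / ν + 1 / (σ + τ) - 1 / (ν + (σ + τ)))) -
      (1 / (μ + ν) + 1 / σ - 1 / (μ + ν + σ) + v * (1 / (μ + ν) + 1 / τ - 1 / (μ + ν + τ) -
        (1 / (μ + ν) + 1 / (σ + τ) - 1 / (μ + ν + (σ + τ)))))) := by
  have c0 : (μ ^ 2 + μ * σ + σ ^ 2) / (μ * σ * (μ + σ)) = 1 / μ + 1 / σ - 1 / (μ + σ) := by
    field_simp; ring
  have c1 : μ * σ * (μ + 2 * ν + σ) / (ν * (μ + ν) * (ν + σ) * (μ + ν + σ)) =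
      1 / ν - 1 / (ν + σ) - 1 / (μ + ν) + 1 / (μ + ν + σ) := by
    field_simp; ring
  have c2 : μ * σ * (μ + σ + 2 * τ) / (τ * (μ + τ) * (σ + τ) * (μ + σ + τ)) =
      1 / τ - 1 / (μ + τ) - 1 / (σ + τ) + 1 / (μ + σ + τ) := by
    field_simp; ring
  have c3 : μ * σ * (μ + 2 * ν + 2 * τ + σ) /
      ((ν + τ) * (μ + ν + τ) * (ν + σ + τ) * (μ + ν + σ + τ)) =
      1 / (ν + τ) - 1 / (ν + σ + τ) - 1 / (μ + ν + τ) + 1 / (μ + ν + σ + τ) := by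
    field_simp; ring
  simp only [q₁, c0, c1, c2, c3, dotProduct, Fin.sum_univ_four, Matrix.cons_val]
  simp only [← add_assoc]
  ring

omit hμ hν hσ hτ in
-- Passing from d ≤ 0 to d > 0 amounts to swapping the two columns of the matrix.
lemma q₂_eq : q₂ μ ν σ τ = q₁ ν μ τ σ := by
  ext i
  fin_cases i <;> simp only [q₁, q₂] <;> simp <;> ring

lemma integral_maxIncr (d : ℝ) :
    ∫ a, maxIncr d a ∂noiseLaw μ ν σ τ =
      q₁ μ ν σ τ ⬝ᵥ (fun i => expBasis μ ν σ τ d (Sum.inl i)) +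
        q₂ μ ν σ τ ⬝ᵥ (fun i => expBasis μ ν σ τ d (Sum.inr i)) := by
  have hm : Measurable (Function.uncurry fun x y : ℝ => max x y) :=
    measurable_fst.max measurable_snd
  have hg : ∀ x y : ℝ, |max x y| ≤ 1 + |x| + |y| := fun x y => by
    have := abs_max_le_max_abs_abs (a := x) (b := y)
    have := max_le_add_of_nonneg (abs_nonneg x) (abs_nonneg y)
    linarith
  have hB := fun r s (h1 : 0 < r) (h2 : 0 < s) => integral_integral_max h1 h2
  rcases le_or_gt d 0 with hd | hd
  · have h := (integral_noiseLaw_of_nonpos hμ hν hσ hτ hd hm hg hB).2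
    simp only [maxIncr, max_eq_left hd, sub_zero]
    rw [h, expBasis_inl_of_nonpos hd, expBasis_inr_of_nonpos hd, dotProduct_zero, add_zero]
    rw [q₁_dotProduct hμ hν hσ hτ]
  · have h := (integral_noiseLaw_of_nonneg hμ hν hσ hτ hd.le hm hg hB).2
    have h1 : ∀ a : (ℝ × ℝ) × (ℝ × ℝ), maxIncr d a =
        max (max (a.1.1 - d) a.1.2) (max (a.2.1 - d) a.2.2) := fun a => by
      simp only [maxIncr, max_eq_right hd.le, max_add_eq_max_sub_add, max_add_add_right,
        add_sub_cancel_right]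
    simp only [h1]
    rw [h, expBasis_inl_of_pos hd, expBasis_inr_of_pos hd, dotProduct_zero, zero_add, q₂_eq,
      q₁_dotProduct hν hμ hτ hσ]

end Step

/-! ### Oscillation of functions in the span of the basis -/

lemma measurable_expBasis (μ ν σ τ : ℝ) (i : Fin 4 ⊕ Fin 4) :
    Measurable fun d => expBasis μ ν σ τ d i := by
  rcases i with i | i
  · exact Measurable.ite measurableSet_Iic (by fun_prop) (by fun_prop)
  · exact Measurable.ite measurableSet_Ioi (by fun_prop) (by fun_prop)

lemma measurable_dotProduct_expBasis (μ ν σ τ : ℝ) (c : Fin 4 ⊕ Fin 4 → ℝ) :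
    Measurable fun d => c ⬝ᵥ expBasis μ ν σ τ d := by
  have := measurable_expBasis μ ν σ τ
  unfold dotProduct
  fun_prop

lemma measurable_nextDiff (d : ℝ) : Measurable (nextDiff d) := by
  unfold nextDiff
  fun_prop

lemma expMeasure_Ioc_pos {r x y : ℝ} (hr : 0 < r) (hx : 0 ≤ x) (hxy : x < y) :
    0 < expMeasure r (Set.Ioc x y) := by
  have := isProbabilityMeasure_expMeasure hr
  rw [← Set.Iic_sdiff_Iic, measure_sdiff (Set.Iic_subset_Iic.2 hxy.le)
    measurableSet_Iic.nullMeasurableSet (measure_ne_top _ _), expMeasure_Iic hr, expMeasure_Iic hr,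
    if_pos hx, if_pos (hx.trans hxy.le), tsub_pos_iff_lt]
  have h1 : Real.exp (-(r * y)) < Real.exp (-(r * x)) := by
    rw [Real.exp_lt_exp]
    nlinarith
  have h2 : Real.exp (-(r * y)) < 1 := by
    rw [Real.exp_lt_one_iff]
    nlinarith
  exact (ENNReal.ofReal_lt_ofReal_iff (by linarith)).2 (by linarith)

/-- If two functions differ by at most `K`, and by at most `K'` on `G`, then their means differ by
at most `K - (K - K') P(G)`. -/
lemma abs_integral_sub_integral_le {α : Type*} [MeasurableSpace α] {ρ : Measure α}
    [IsProbabilityMeasure ρ] {f g : α → ℝ} (hf : Integrable f ρ) (hg : Integrable g ρ)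
    {G : Set α} (hG : MeasurableSet G) {K K' : ℝ} (hK : ∀ a, |f a - g a| ≤ K)
    (hK' : ∀ a ∈ G, |f a - g a| ≤ K') :
    |∫ a, f a ∂ρ - ∫ a, g a ∂ρ| ≤ K - (K - K') * ρ.real G := by
  rw [← integral_sub hf hg]
  have hi : Integrable (G.indicator fun _ => K - K') ρ := (integrable_const _).indicator hG
  calc |∫ a, (f a - g a) ∂ρ| ≤ ∫ a, |f a - g a| ∂ρ := abs_integral_le_integral_abs
    _ ≤ ∫ a, (K - G.indicator (fun _ => K - K') a) ∂ρ := by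
        refine integral_mono (hf.sub hg).abs ((integrable_const _).sub hi) fun a => ?_
        by_cases ha : a ∈ G
        · simpa [ha] using hK' a ha
        · simpa [ha] using hK a
    _ = K - (K - K') * ρ.real G := by
        rw [integral_sub (integrable_const _) hi, integral_indicator_const _ hG]
        simp [mul_comm]

section

variable {μ ν σ τ : ℝ} (hμ : 0 < μ) (hν : 0 < ν) (hσ : 0 < σ) (hτ : 0 < τ)
include hμ hν hσ hτ

lemma abs_expBasis_le_one (d : ℝ) (i : Fin 4 ⊕ Fin 4) : |expBasis μ ν σ τ d i| ≤ 1 := by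
  rcases i with i | i
  · have h := rate₁_nonneg hν hτ i
    simp only [expBasis, Sum.elim_inl]
    rw [← neg_neg (rate₁ ν τ i * d)]
    exact abs_ite_exp_le_one fun hd => by nlinarith
  · have h := rate₂_nonneg hμ hσ i
    simp only [expBasis, Sum.elim_inr]
    exact abs_ite_exp_le_one fun hd => by positivity

lemma abs_dotProduct_expBasis_le (c : Fin 4 ⊕ Fin 4 → ℝ) (d : ℝ) :
    |c ⬝ᵥ expBasis μ ν σ τ d| ≤ ∑ i, |c i| := by
  refine (Finset.abs_sum_le_sum_abs _ _).trans (Finset.sum_le_sum fun i _ => ?_)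
  rw [abs_mul]
  exact mul_le_of_le_one_right (abs_nonneg _) (abs_expBasis_le_one hμ hν hσ hτ d i)

lemma integrable_dotProduct_expBasis_comp {α : Type*} [MeasurableSpace α] {ρ : Measure α}
    [IsFiniteMeasure ρ] {g : α → ℝ} (hg : Measurable g) (c : Fin 4 ⊕ Fin 4 → ℝ) :
    Integrable (fun a => c ⬝ᵥ expBasis μ ν σ τ (g a)) ρ :=
  Integrable.mono' (integrable_const (∑ i, |c i|))
    ((measurable_dotProduct_expBasis μ ν σ τ c).comp hg).aestronglyMeasurable
    (Eventually.of_forall fun _ => abs_dotProduct_expBasis_le hμ hν hσ hτ c _)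

lemma integral_dotProduct_expBasis_comp {α : Type*} [MeasurableSpace α] {ρ : Measure α}
    [IsFiniteMeasure ρ] {g : α → ℝ} (hg : Measurable g) (c : Fin 4 ⊕ Fin 4 → ℝ) :
    ∫ a, c ⬝ᵥ expBasis μ ν σ τ (g a) ∂ρ = c ⬝ᵥ fun i => ∫ a, expBasis μ ν σ τ (g a) i ∂ρ := by
  simp only [dotProduct]
  rw [integral_finsetSum]
  · simp only [integral_const_mul]
  · intro i _
    refine Integrable.const_mul (Integrable.mono' (integrable_const 1)
      ((measurable_expBasis μ ν σ τ i).comp hg).aestronglyMeasurable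
      (Eventually.of_forall fun _ => abs_expBasis_le_one hμ hν hσ hτ _ i)) _

/-- On coefficient vectors the transition operator is right multiplication by W, so powers of W
encode several steps of the chain. -/
lemma integral_dotProduct_expBasis_nextDiff (c : Fin 4 ⊕ Fin 4 → ℝ) (d : ℝ) :
    ∫ a, c ⬝ᵥ expBasis μ ν σ τ (nextDiff d a) ∂noiseLaw μ ν σ τ =
      (c ᵥ* W μ ν σ τ) ⬝ᵥ expBasis μ ν σ τ d := by
  have := isProbabilityMeasure_noiseLaw hμ hν hσ hτ
  rw [integral_dotProduct_expBasis_comp hμ hν hσ hτ (measurable_nextDiff d),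
    ← Matrix.dotProduct_mulVec]
  simp only [integral_expBasis_nextDiff hμ hν hσ hτ]

omit hμ hν hσ hτ in
-- Corresponding entries of the two rows differ by at most 1, hence so do the two maxima, however
-- large d is.
lemma abs_nextDiff_le_one {a : (ℝ × ℝ) × (ℝ × ℝ)}
    (ha : a ∈ (Set.Ioc (0 : ℝ) 1 ×ˢ Set.Ioc (0 : ℝ) 1) ×ˢ
    (Set.Ioc (0 : ℝ) 1 ×ˢ Set.Ioc (0 : ℝ) 1)) (d : ℝ) : |nextDiff d a| ≤ 1 := by
  obtain ⟨⟨⟨h1, h2⟩, h3, h4⟩, ⟨h5, h6⟩, h7, h8⟩ := ha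
  rw [nextDiff, abs_le]
  rcases max_cases a.2.1 (a.2.2 + d) with h | h <;>
    rcases max_cases a.1.1 (a.1.2 + d) with h' | h' <;>
    constructor <;> linarith

omit hμ hν hσ hτ in
-- With d and the second column at most 1 and the first column above 2, both maxima are attained in
-- the first column, and d is forgotten.
lemma nextDiff_eq_sub {a : (ℝ × ℝ) × (ℝ × ℝ)}
    (ha : a ∈ (Set.Ioc (2 : ℝ) 3 ×ˢ Set.Ioc (0 : ℝ) 1) ×ˢ
    (Set.Ioc (2 : ℝ) 3 ×ˢ Set.Ioc (0 : ℝ) 1)) {d : ℝ} (hd : |d| ≤ 1) :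
    nextDiff d a = a.2.1 - a.1.1 := by
  obtain ⟨⟨⟨h1, h2⟩, h3, h4⟩, ⟨h5, h6⟩, h7, h8⟩ := ha
  have := (abs_le.1 hd).2
  rw [nextDiff, max_eq_left (by linarith), max_eq_left (by linarith)]

lemma noiseLaw_real_prod_pos {x₁ y₁ x₂ y₂ x₃ y₃ x₄ y₄ : ℝ} (h₁ : 0 ≤ x₁ ∧ x₁ < y₁)
    (h₂ : 0 ≤ x₂ ∧ x₂ < y₂) (h₃ : 0 ≤ x₃ ∧ x₃ < y₃) (h₄ : 0 ≤ x₄ ∧ x₄ < y₄) :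
    0 < (noiseLaw μ ν σ τ).real
      ((Set.Ioc x₁ y₁ ×ˢ Set.Ioc x₂ y₂) ×ˢ (Set.Ioc x₃ y₃ ×ˢ Set.Ioc x₄ y₄)) := by
  have := isProbabilityMeasure_expMeasure hμ
  have := isProbabilityMeasure_expMeasure hν
  have := isProbabilityMeasure_expMeasure hσ
  have := isProbabilityMeasure_expMeasure hτ
  have := isProbabilityMeasure_noiseLaw hμ hν hσ hτ
  rw [measureReal_def, ENNReal.toReal_pos_iff]
  refine ⟨?_, measure_lt_top _ _⟩
  rw [noiseLaw, Measure.prod_prod, Measure.prod_prod, Measure.prod_prod]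
  have e1 := (expMeasure_Ioc_pos hμ h₁.1 h₁.2).ne'
  have e2 := (expMeasure_Ioc_pos hν h₂.1 h₂.2).ne'
  have e3 := (expMeasure_Ioc_pos hσ h₃.1 h₃.2).ne'
  have e4 := (expMeasure_Ioc_pos hτ h₄.1 h₄.2).ne'
  exact pos_iff_ne_zero.2 (mul_ne_zero (mul_ne_zero e1 e2) (mul_ne_zero e3 e4))

/-- Two steps of the transition operator contract the oscillation: with positive probability the
chain forgets its starting point within two steps. -/
lemma exists_contraction : ∃ θ : ℝ, 0 ≤ θ ∧ θ < 1 ∧ ∀ (c : Fin 4 ⊕ Fin 4 → ℝ) (K : ℝ),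
    (∀ d d', |c ⬝ᵥ expBasis μ ν σ τ d - c ⬝ᵥ expBasis μ ν σ τ d'| ≤ K) →
    ∀ d d', |(c ᵥ* (W μ ν σ τ * W μ ν σ τ)) ⬝ᵥ expBasis μ ν σ τ d -
      (c ᵥ* (W μ ν σ τ * W μ ν σ τ)) ⬝ᵥ expBasis μ ν σ τ d'| ≤ θ * K := by
  have hP := isProbabilityMeasure_noiseLaw hμ hν hσ hτ
  set ρ := noiseLaw μ ν σ τ with hρ
  set G₁ : Set ((ℝ × ℝ) × (ℝ × ℝ)) := (Set.Ioc (0 : ℝ) 1 ×ˢ Set.Ioc (0 : ℝ) 1) ×ˢ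
    (Set.Ioc (0 : ℝ) 1 ×ˢ Set.Ioc (0 : ℝ) 1) with hG₁
  set G₂ : Set ((ℝ × ℝ) × (ℝ × ℝ)) := (Set.Ioc (2 : ℝ) 3 ×ˢ Set.Ioc (0 : ℝ) 1) ×ˢ
    (Set.Ioc (2 : ℝ) 3 ×ˢ Set.Ioc (0 : ℝ) 1) with hG₂
  have m₁ : MeasurableSet G₁ := (measurableSet_Ioc.prod measurableSet_Ioc).prod
    (measurableSet_Ioc.prod measurableSet_Ioc)
  have m₂ : MeasurableSet G₂ := (measurableSet_Ioc.prod measurableSet_Ioc).prod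
    (measurableSet_Ioc.prod measurableSet_Ioc)
  have p₁ : 0 < ρ.real G₁ := by
    apply noiseLaw_real_prod_pos hμ hν hσ hτ <;> norm_num
  have p₂ : 0 < ρ.real G₂ := by
    apply noiseLaw_real_prod_pos hμ hν hσ hτ <;> norm_num
  have l₁ : ρ.real G₁ ≤ 1 := measureReal_le_one
  have l₂ : ρ.real G₂ ≤ 1 := measureReal_le_one
  have hint := fun (c : Fin 4 ⊕ Fin 4 → ℝ) (d : ℝ) =>
    integrable_dotProduct_expBasis_comp hμ hν hσ hτ (ρ := ρ) (measurable_nextDiff d) c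
  -- The event `G₁` brings any two starting points into [-1, 1], and `G₂` then merges them. Coupling
  -- through the same noise saves a fraction P(G₁)P(G₂) of the oscillation.
  refine ⟨1 - ρ.real G₁ * ρ.real G₂, by nlinarith, by nlinarith [mul_pos p₁ p₂],
    fun c K hK d d' => ?_⟩
  -- A single averaging step never increases the oscillation.
  have hK₁ : ∀ d d', |(c ᵥ* W μ ν σ τ) ⬝ᵥ expBasis μ ν σ τ d -
      (c ᵥ* W μ ν σ τ) ⬝ᵥ expBasis μ ν σ τ d'| ≤ K := fun d d' => by
    rw [← integral_dotProduct_expBasis_nextDiff hμ hν hσ hτ,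
      ← integral_dotProduct_expBasis_nextDiff hμ hν hσ hτ]
    have := abs_integral_sub_integral_le (hint c d) (hint c d') MeasurableSet.univ
      (fun a => hK _ _) (fun a _ => hK _ _)
    simpa using this
  have hK₂ : ∀ d d', |d| ≤ 1 → |d'| ≤ 1 → |(c ᵥ* W μ ν σ τ) ⬝ᵥ expBasis μ ν σ τ d -
      (c ᵥ* W μ ν σ τ) ⬝ᵥ expBasis μ ν σ τ d'| ≤ K - K * ρ.real G₂ := fun d d' hd hd' => by
    rw [← integral_dotProduct_expBasis_nextDiff hμ hν hσ hτ,
      ← integral_dotProduct_expBasis_nextDiff hμ hν hσ hτ]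
    have := abs_integral_sub_integral_le (hint c d) (hint c d') m₂ (K' := 0)
      (fun a => hK _ _) (fun a ha => by
        rw [nextDiff_eq_sub ha hd, nextDiff_eq_sub ha hd']
        simp)
    simpa using this
  rw [← Matrix.vecMul_vecMul, ← integral_dotProduct_expBasis_nextDiff hμ hν hσ hτ,
    ← integral_dotProduct_expBasis_nextDiff hμ hν hσ hτ]
  have := abs_integral_sub_integral_le (hint _ d) (hint _ d') m₁
      (fun a => hK₁ _ _)
      (fun a ha => hK₂ _ _ (abs_nextDiff_le_one ha d) (abs_nextDiff_le_one ha d'))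
  refine this.trans (le_of_eq ?_)
  ring

/-! ### The kernel of `1 - W` -/

/-- Pairing c with a column of U₁ averages the function c·`expBasis` over a reflected exponential
law, which charges only d < 0, where the second block of the basis vanishes. -/
lemma sum_U₁_mul (c : Fin 4 ⊕ Fin 4 → ℝ) (j : Fin 3) : ∑ i, c (Sum.inl i) * U₁ μ ν τ i j =
    ∫ t, c ⬝ᵥ expBasis μ ν σ τ (-t) ∂expMeasure (![μ, ν, μ + ν] j) := by
  have hj : 0 < ![μ, ν, μ + ν] j := by
    fin_cases j <;> simp <;> positivity
  have := isProbabilityMeasure_expMeasure hj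
  rw [integral_dotProduct_expBasis_comp hμ hν hσ hτ measurable_neg, dotProduct,
    Fintype.sum_sum_type]
  have h1 : ∀ i, ∫ t, expBasis μ ν σ τ (-t) (Sum.inl i) ∂expMeasure (![μ, ν, μ + ν] j) =
      U₁ μ ν τ i j := fun i => by
    have h := integral_exp_expMeasure hj (rate₁_nonneg hν hτ i)
    rw [U₁_row hμ hν]
    have h' : ![μ / (μ + rate₁ ν τ i), ν / (ν + rate₁ ν τ i),
        (μ + ν) / (μ + ν + rate₁ ν τ i)] j =
        ![μ, ν, μ + ν] j / (![μ, ν, μ + ν] j + rate₁ ν τ i) := by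
      fin_cases j <;> rfl
    rw [h', ← h]
    refine integral_congr_ae ?_
    filter_upwards [ae_pos_expMeasure hj] with t ht
    simp [expBasis, ht.le]
  have h2 : ∀ i, ∫ t, expBasis μ ν σ τ (-t) (Sum.inr i) ∂expMeasure (![μ, ν, μ + ν] j) = 0 :=
    fun i => by
      refine integral_eq_zero_of_ae ?_
      filter_upwards [ae_pos_expMeasure hj] with t ht
      simp [expBasis, ht.le]
  simp only [h1, h2, mul_zero, Finset.sum_const_zero, add_zero]

lemma sum_U₂_mul (c : Fin 4 ⊕ Fin 4 → ℝ) (j : Fin 3) : ∑ i, c (Sum.inr i) * U₂ μ σ τ i j =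
    ∫ t, c ⬝ᵥ expBasis μ ν σ τ t ∂expMeasure (![σ, τ, σ + τ] j) := by
  have hj : 0 < ![σ, τ, σ + τ] j := by
    fin_cases j <;> simp <;> positivity
  have := isProbabilityMeasure_expMeasure hj
  rw [integral_dotProduct_expBasis_comp hμ hν hσ hτ measurable_id', dotProduct,
    Fintype.sum_sum_type]
  have h1 : ∀ i, ∫ t, expBasis μ ν σ τ t (Sum.inr i) ∂expMeasure (![σ, τ, σ + τ] j) =
      U₂ μ σ τ i j := fun i => by
    have h := integral_exp_expMeasure hj (rate₂_nonneg hμ hσ i)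
    rw [U₂_row hσ hτ]
    have h' : ![σ / (σ + rate₂ μ σ i), τ / (τ + rate₂ μ σ i),
        (σ + τ) / (σ + τ + rate₂ μ σ i)] j =
        ![σ, τ, σ + τ] j / (![σ, τ, σ + τ] j + rate₂ μ σ i) := by
      fin_cases j <;> rfl
    rw [h', ← h]
    refine integral_congr_ae ?_
    filter_upwards [ae_pos_expMeasure hj] with t ht
    simp [expBasis, ht]
  have h2 : ∀ i, ∫ t, expBasis μ ν σ τ t (Sum.inl i) ∂expMeasure (![σ, τ, σ + τ] j) = 0 :=
    fun i => by
      refine integral_eq_zero_of_ae ?_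
      filter_upwards [ae_pos_expMeasure hj] with t ht
      simp [expBasis, ht]
  simp only [h1, h2, mul_zero, Finset.sum_const_zero, zero_add]

/-- A fixed vector of `W` of total mass `0` is bounded, as a functional, by the oscillation. -/
lemma exists_bound_of_fixed {ω : Fin 4 ⊕ Fin 4 → ℝ} (hω : W μ ν σ τ *ᵥ ω = ω)
    (h0 : ω (Sum.inl 0) + ω (Sum.inr 0) = 0) : ∃ C : ℝ, ∀ (c : Fin 4 ⊕ Fin 4 → ℝ) (K : ℝ),
    (∀ d d', |c ⬝ᵥ expBasis μ ν σ τ d - c ⬝ᵥ expBasis μ ν σ τ d'| ≤ K) → |c ⬝ᵥ ω| ≤ C * K := by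
  -- Since W factors through U₁ and U₂, a fixed vector is a combination of their columns, that is,
  -- of six exponential laws on the half lines.
  obtain ⟨v, hv⟩ : ∃ v : Fin 3 → ℝ, ∀ i, ω (Sum.inl i) = U₁ μ ν τ i ⬝ᵥ v :=
    ⟨_, fun i => by rw [← W_mulVec_inl, hω]⟩
  obtain ⟨w, hw⟩ : ∃ w : Fin 3 → ℝ, ∀ i, ω (Sum.inr i) = U₂ μ σ τ i ⬝ᵥ w :=
    ⟨_, fun i => by rw [← W_mulVec_inr, hω]⟩
  -- The first rows of U₁ and U₂ consist of ones, so the signed combination has total weight 0, and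
  -- the value of the function at d = 0 may be subtracted from every average.
  have hs : ∑ j, v j + ∑ j, w j = 0 := by
    rw [← h0, hv, hw]
    simp [dotProduct, Fin.sum_univ_three, U₁, U₂]
  refine ⟨∑ j, |v j| + ∑ j, |w j|, fun c K hK => ?_⟩
  have hr₁ : ∀ j, 0 < ![μ, ν, μ + ν] j := fun j => by
    fin_cases j <;> simp <;> positivity
  have hr₂ : ∀ j, 0 < ![σ, τ, σ + τ] j := fun j => by
    fin_cases j <;> simp <;> positivity
  have hbd : ∀ (r : ℝ) (g : ℝ → ℝ), 0 < r → Measurable g →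
      |∫ t, c ⬝ᵥ expBasis μ ν σ τ (g t) ∂expMeasure r - c ⬝ᵥ expBasis μ ν σ τ 0| ≤ K :=
    fun r g hr hg => by
      have := isProbabilityMeasure_expMeasure hr
      have h := abs_integral_sub_integral_le
        (integrable_dotProduct_expBasis_comp hμ hν hσ hτ (ρ := expMeasure r) hg c)
        (integrable_const (c ⬝ᵥ expBasis μ ν σ τ 0)) MeasurableSet.univ
        (fun a => hK _ _) (fun a _ => hK _ _)
      simpa using h
  have hc : c ⬝ᵥ ω =
      ∑ j, v j * (∑ i, c (Sum.inl i) * U₁ μ ν τ i j - c ⬝ᵥ expBasis μ ν σ τ 0) +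
      ∑ j, w j * (∑ i, c (Sum.inr i) * U₂ μ σ τ i j - c ⬝ᵥ expBasis μ ν σ τ 0) := by
    have e1 : ∑ j, v j * ∑ i, c (Sum.inl i) * U₁ μ ν τ i j =
        ∑ i, c (Sum.inl i) * ω (Sum.inl i) := by
      simp only [hv, dotProduct, Finset.mul_sum]
      rw [Finset.sum_comm]
      exact Finset.sum_congr rfl fun i _ => Finset.sum_congr rfl fun j _ => by ring
    have e2 : ∑ j, w j * ∑ i, c (Sum.inr i) * U₂ μ σ τ i j =
        ∑ i, c (Sum.inr i) * ω (Sum.inr i) := by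
      simp only [hw, dotProduct, Finset.mul_sum]
      rw [Finset.sum_comm]
      exact Finset.sum_congr rfl fun i _ => Finset.sum_congr rfl fun j _ => by ring
    simp only [mul_sub, Finset.sum_sub_distrib, e1, e2, ← Finset.sum_mul]
    rw [dotProduct, Fintype.sum_sum_type]
    linear_combination (c ⬝ᵥ expBasis μ ν σ τ 0) * hs
  rw [hc, add_mul, Finset.sum_mul, Finset.sum_mul]
  refine (abs_add_le _ _).trans (add_le_add ?_ ?_)
  · refine (Finset.abs_sum_le_sum_abs _ _).trans (Finset.sum_le_sum fun j _ => ?_)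
    rw [abs_mul, sum_U₁_mul hμ hν hσ hτ]
    exact mul_le_mul_of_nonneg_left (hbd _ _ (hr₁ j) measurable_neg) (abs_nonneg _)
  · refine (Finset.abs_sum_le_sum_abs _ _).trans (Finset.sum_le_sum fun j _ => ?_)
    rw [abs_mul, sum_U₂_mul hμ hν hσ hτ]
    exact mul_le_mul_of_nonneg_left (hbd _ _ (hr₂ j) measurable_id') (abs_nonneg _)

/-- For each coordinate functional c, c·ω = (cW²ⁿ)·ω is bounded by a constant times the oscillation
of cW²ⁿ, which decays geometrically. Linear independence of the basis functions is not needed; it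
fails when ν = τ. -/
lemma eq_zero_of_fixed {ω : Fin 4 ⊕ Fin 4 → ℝ} (hω : W μ ν σ τ *ᵥ ω = ω)
    (h0 : ω (Sum.inl 0) + ω (Sum.inr 0) = 0) : ω = 0 := by
  obtain ⟨C, hC⟩ := exists_bound_of_fixed hμ hν hσ hτ hω h0
  obtain ⟨θ, hθ0, hθ1, hθ⟩ := exists_contraction hμ hν hσ hτ
  ext k
  set c : Fin 4 ⊕ Fin 4 → ℝ := Pi.single k 1
  set K := ∑ i, |c i| + ∑ i, |c i|
  have hosc : ∀ n : ℕ, ∀ d d', |(c ᵥ* (W μ ν σ τ * W μ ν σ τ) ^ n) ⬝ᵥ expBasis μ ν σ τ d -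
      (c ᵥ* (W μ ν σ τ * W μ ν σ τ) ^ n) ⬝ᵥ expBasis μ ν σ τ d'| ≤ θ ^ n * K := by
    intro n
    induction n with
    | zero =>
      intro d d'
      simp only [pow_zero, Matrix.vecMul_one, one_mul]
      exact (abs_sub _ _).trans (add_le_add (abs_dotProduct_expBasis_le hμ hν hσ hτ c d)
        (abs_dotProduct_expBasis_le hμ hν hσ hτ c d'))
    | succ n ih =>
      intro d d'
      have := hθ _ _ ih d d'
      rwa [Matrix.vecMul_vecMul, ← pow_succ, ← mul_assoc, ← pow_succ'] at this
  have hfix : ∀ n : ℕ, (W μ ν σ τ * W μ ν σ τ) ^ n *ᵥ ω = ω := by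
    intro n
    induction n with
    | zero => simp
    | succ n ih => rw [pow_succ, ← Matrix.mulVec_mulVec, ← Matrix.mulVec_mulVec, hω, hω, ih]
  have hle : ∀ n : ℕ, |ω k| ≤ C * (θ ^ n * K) := fun n => by
    have := hC _ _ (hosc n)
    rw [← Matrix.dotProduct_mulVec, hfix] at this
    simpa [c] using this
  have hlim : Tendsto (fun n : ℕ => C * (θ ^ n * K)) atTop (𝓝 0) := by
    have := ((tendsto_pow_atTop_nhds_zero_of_lt_one hθ0 hθ1).mul_const K).const_mul C
    simpa using this
  exact abs_eq_zero.1 (le_antisymm (ge_of_tendsto' hlim hle) (abs_nonneg _))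

end

/-- The functional `ω ↦ ω₁₀ + ω₂₀`. -/
def totalMass : Fin 4 ⊕ Fin 4 → ℝ := Sum.elim ![1, 0, 0, 0] ![1, 0, 0, 0]

lemma totalMass_dotProduct (ω : Fin 4 ⊕ Fin 4 → ℝ) :
    totalMass ⬝ᵥ ω = ω (Sum.inl 0) + ω (Sum.inr 0) := by
  simp [totalMass, dotProduct, Fin.sum_univ_four]

lemma totalMass_dotProduct_expBasis (μ ν σ τ d : ℝ) : totalMass ⬝ᵥ expBasis μ ν σ τ d = 1 := by
  rw [totalMass_dotProduct]
  rcases le_or_gt d 0 with hd | hd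
  · simp [expBasis, rate₁, hd, hd.not_gt]
  · simp [expBasis, rate₂, hd, hd.not_ge]

/-! ### Left eigenvector, the unique solution, and the Poisson equation -/

section

variable {μ ν σ τ : ℝ} (hμ : 0 < μ) (hν : 0 < ν) (hσ : 0 < σ) (hτ : 0 < τ)
include hμ hν hσ hτ

lemma sum_V₁₁_add_sum_V₂₁ (j : Fin 4) :
    ∑ i, V₁₁ μ ν σ τ i j + ∑ i, V₂₁ μ ν σ τ i j = ![1, 0, 0, 0] j := by
  fin_cases j <;> simp [V₁₁, V₂₁, Fin.sum_univ_three] <;> field_simp <;> ring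

lemma sum_V₁₂_add_sum_V₂₂ (j : Fin 4) :
    ∑ i, V₁₂ μ ν σ τ i j + ∑ i, V₂₂ μ ν σ τ i j = ![1, 0, 0, 0] j := by
  fin_cases j <;> simp [V₁₂, V₂₂, Fin.sum_univ_three] <;> field_simp <;> ring

/-- Conservation of probability: `totalMass` represents the constant function 1. As the basis
functions may be dependent, the vector identity is checked on the column sums of the V blocks, the
first rows of U₁ and U₂ being ones. -/
lemma totalMass_vecMul_W : totalMass ᵥ* W μ ν σ τ = totalMass := by
  have key : ∀ x, totalMass ⬝ᵥ (W μ ν σ τ *ᵥ x) = totalMass ⬝ᵥ x := fun x => by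
    rw [totalMass_dotProduct, totalMass_dotProduct, W_mulVec_inl, W_mulVec_inr]
    have h1 : U₁ μ ν τ 0 = 1 := by ext j; fin_cases j <;> rfl
    have h2 : U₂ μ σ τ 0 = 1 := by ext j; fin_cases j <;> rfl
    have hs : ∀ (V V' : Matrix (Fin 3) (Fin 4) ℝ) (y : Fin 4 → ℝ),
        (∀ j, ∑ i, V i j + ∑ i, V' i j = ![1, 0, 0, 0] j) →
        1 ⬝ᵥ (V *ᵥ y) + 1 ⬝ᵥ (V' *ᵥ y) = y 0 := fun V V' y h => by
      have e : 1 ᵥ* V + 1 ᵥ* V' = ![1, 0, 0, 0] := by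
        ext j
        rw [← h j]
        simp [Matrix.vecMul, dotProduct]
      rw [Matrix.dotProduct_mulVec, Matrix.dotProduct_mulVec, ← add_dotProduct, e]
      simp [dotProduct, Fin.sum_univ_four]
    have e1 := hs _ _ (fun j => x (Sum.inl j)) (sum_V₁₁_add_sum_V₂₁ hμ hν hσ hτ)
    have e2 := hs _ _ (fun j => x (Sum.inr j)) (sum_V₁₂_add_sum_V₂₂ hμ hν hσ hτ)
    rw [h1, h2, dotProduct_add, dotProduct_add]
    linarith
  ext j
  have := key (Pi.single j 1)
  rwa [Matrix.dotProduct_mulVec, dotProduct_single_one, dotProduct_single_one] at this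

/-- A left null vector makes 1 - W singular, so a right null vector exists; its mass is nonzero by
`eq_zero_of_fixed` and can be normalized. -/
lemma exists_isSolution : ∃ ω, IsSolution μ ν σ τ ω := by
  have hdet : (1 - W μ ν σ τ).det = 0 := by
    rw [← Matrix.exists_vecMul_eq_zero_iff]
    refine ⟨totalMass, fun h => ?_, ?_⟩
    · have := congrFun h (Sum.inl 0)
      simp [totalMass] at this
    · rw [Matrix.vecMul_sub, Matrix.vecMul_one, totalMass_vecMul_W hμ hν hσ hτ, sub_self]
  obtain ⟨v, hv0, hv⟩ := Matrix.exists_mulVec_eq_zero_iff.2 hdet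
  have hfix : W μ ν σ τ *ᵥ v = v := by
    rw [Matrix.sub_mulVec, Matrix.one_mulVec, sub_eq_zero] at hv
    exact hv.symm
  have hm : v (Sum.inl 0) + v (Sum.inr 0) ≠ 0 := fun h => hv0 (eq_zero_of_fixed hμ hν hσ hτ hfix h)
  refine ⟨(v (Sum.inl 0) + v (Sum.inr 0))⁻¹ • v, ?_, ?_⟩
  · rw [Matrix.mulVec_smul, hv, smul_zero]
  · simp only [Pi.smul_apply, smul_eq_mul]
    rw [← mul_add, inv_mul_cancel₀ hm]

lemma existsUnique_isSolution : ∃! ω, IsSolution μ ν σ τ ω := by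
  obtain ⟨ω, hω⟩ := exists_isSolution hμ hν hσ hτ
  refine ⟨ω, hω, fun ω' hω' => ?_⟩
  rw [← sub_eq_zero]
  refine eq_zero_of_fixed hμ hν hσ hτ ?_ ?_
  · have h : (1 - W μ ν σ τ) *ᵥ (ω' - ω) = 0 := by
      rw [Matrix.mulVec_sub, hω.1, hω'.1, sub_zero]
    rw [Matrix.sub_mulVec, Matrix.one_mulVec, sub_eq_zero] at h
    exact h.symm
  · have h1 := hω.2
    have h2 := hω'.2
    simp only [Pi.sub_apply]
    linarith

/-- The Poisson equation `c (1 - W) = q - (q ⬝ ω) e` is solvable. -/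
lemma exists_poisson {ω : Fin 4 ⊕ Fin 4 → ℝ} (hω : IsSolution μ ν σ τ ω)
    (q : Fin 4 ⊕ Fin 4 → ℝ) :
    ∃ c, c ᵥ* W μ ν σ τ = c - q + (q ⬝ᵥ ω) • totalMass := by
  -- The rank-one term repairs the one-dimensional kernel of 1 - W, so N is invertible.
  set N := (1 - W μ ν σ τ) + Matrix.vecMulVec ω totalMass with hN
  have hmass : totalMass ⬝ᵥ ω = 1 := by rw [totalMass_dotProduct, hω.2]
  have hdet : N.det ≠ 0 := by
    intro h
    obtain ⟨v, hv0, hv⟩ := Matrix.exists_mulVec_eq_zero_iff.2 h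
    have hNv : N *ᵥ v = (1 - W μ ν σ τ) *ᵥ v + (totalMass ⬝ᵥ v) • ω := by
      rw [hN, Matrix.add_mulVec, Matrix.vecMulVec_mulVec]
      simp
    have h1 : totalMass ⬝ᵥ v = 0 := by
      have h2 := congrArg (fun w => totalMass ⬝ᵥ w) (hNv.symm.trans hv)
      simp only [dotProduct_add, dotProduct_smul, hmass, dotProduct_zero] at h2
      rw [Matrix.dotProduct_mulVec, Matrix.vecMul_sub, Matrix.vecMul_one,
        totalMass_vecMul_W hμ hν hσ hτ, sub_self, zero_dotProduct] at h2
      simpa using h2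
    rw [hNv, h1, zero_smul, add_zero, Matrix.sub_mulVec, Matrix.one_mulVec, sub_eq_zero] at hv
    rw [totalMass_dotProduct] at h1
    exact hv0 (eq_zero_of_fixed hμ hν hσ hτ hv.symm h1)
  obtain ⟨c, hc⟩ : ∃ c, c ᵥ* N = q := ⟨q ᵥ* N⁻¹, by
    rw [Matrix.vecMul_vecMul, Matrix.nonsing_inv_mul _ (isUnit_iff_ne_zero.2 hdet),
      Matrix.vecMul_one]⟩
  have hcN : c ᵥ* N = c - c ᵥ* W μ ν σ τ + (c ⬝ᵥ ω) • totalMass := by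
    rw [hN, Matrix.vecMul_add, Matrix.vecMul_sub, Matrix.vecMul_one, Matrix.vecMul_vecMulVec]
  -- N fixes ω, because (1 - W)ω = 0 and ω has mass 1.
  have hcω : c ⬝ᵥ ω = q ⬝ᵥ ω := by
    rw [← hc, ← Matrix.dotProduct_mulVec, hN, Matrix.add_mulVec, hω.1, Matrix.vecMulVec_mulVec,
      hmass]
    simp
  rw [hc, hcω] at hcN
  refine ⟨c, ?_⟩
  ext i
  have := congrFun hcN i
  simp only [Pi.add_apply, Pi.sub_apply] at this ⊢
  linarith

end

/-! ### Second moments of the increments -/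

lemma measurable_maxIncr (d : ℝ) : Measurable (maxIncr d) := by
  unfold maxIncr
  fun_prop

lemma abs_maxIncr_le (d : ℝ) (a : (ℝ × ℝ) × (ℝ × ℝ)) :
    |maxIncr d a| ≤ |a.1.1| + |a.1.2| + |a.2.1| + |a.2.2| := by
  have h1 := abs_nonneg a.1.1
  have h2 := abs_nonneg a.1.2
  have h3 := abs_nonneg a.2.1
  have h4 := abs_nonneg a.2.2
  have h5 := abs_le.1 (le_refl |a.1.1|)
  have h6 := abs_le.1 (le_refl |a.1.2|)
  have h7 := abs_le.1 (le_refl |a.2.1|)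
  have h8 := abs_le.1 (le_refl |a.2.2|)
  have h9 := le_max_left 0 d
  have h10 := le_max_right 0 d
  rw [maxIncr, abs_le]
  constructor
  · rw [neg_le_sub_iff_le_add, max_le_iff]
    have e1 := le_max_left (max a.1.1 (a.1.2 + d)) (max a.2.1 (a.2.2 + d))
    have e2 := le_max_left a.1.1 (a.1.2 + d)
    have e3 := le_max_right a.1.1 (a.1.2 + d)
    constructor <;> linarith
  · rw [sub_le_iff_le_add]
    refine max_le (max_le ?_ ?_) (max_le ?_ ?_) <;> linarith

lemma integrable_sq_noiseLaw {μ ν σ τ : ℝ} (hμ : 0 < μ) (hν : 0 < ν) (hσ : 0 < σ) (hτ : 0 < τ) :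
    Integrable (fun a : (ℝ × ℝ) × (ℝ × ℝ) =>
      a.1.1 ^ 2 + a.1.2 ^ 2 + a.2.1 ^ 2 + a.2.2 ^ 2) (noiseLaw μ ν σ τ) := by
  have := isProbabilityMeasure_expMeasure hμ
  have := isProbabilityMeasure_expMeasure hν
  have := isProbabilityMeasure_expMeasure hσ
  have := isProbabilityMeasure_expMeasure hτ
  unfold noiseLaw
  exact (((((integrable_pow_expMeasure hμ 2).comp_fst _).comp_fst _).add
    (((integrable_pow_expMeasure hν 2).comp_snd _).comp_fst _)).add
    (((integrable_pow_expMeasure hσ 2).comp_fst _).comp_snd _)).add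
    (((integrable_pow_expMeasure hτ 2).comp_snd _).comp_snd _)

/-- A centred function with bounded second moment adds a bounded amount to a second moment. -/
lemma lintegral_sq_add_le {α : Type*} [MeasurableSpace α] {ρ : Measure α} [IsProbabilityMeasure ρ]
    {ξ S : α → ℝ} (hξ : AEStronglyMeasurable ξ ρ) (hS : Integrable S ρ) (hle : ∀ a, ξ a ^ 2 ≤ S a)
    (h0 : ∫ a, ξ a ∂ρ = 0) (y : ℝ) :
    ∫⁻ a, ENNReal.ofReal ((y + ξ a) ^ 2) ∂ρ ≤
      ENNReal.ofReal (y ^ 2) + ENNReal.ofReal (∫ a, S a ∂ρ) := by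
  have hsq : Integrable (fun a => ξ a ^ 2) ρ :=
    Integrable.mono' hS (hξ.pow 2) (Eventually.of_forall fun a => by
      rw [Real.norm_of_nonneg (sq_nonneg _)]
      exact hle a)
  have hint : Integrable ξ ρ := ((memLp_two_iff_integrable_sq hξ).2 hsq).integrable one_le_two
  have hexp : (fun a => (y + ξ a) ^ 2) = fun a => (y ^ 2 + 2 * y * ξ a) + ξ a ^ 2 := by
    ext a; ring
  have hi1 : Integrable (fun a => y ^ 2 + 2 * y * ξ a) ρ :=
    (integrable_const _).add (hint.const_mul _)
  have hi : Integrable (fun a => (y + ξ a) ^ 2) ρ := by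
    rw [hexp]
    exact hi1.add hsq
  rw [← ofReal_integral_eq_lintegral_ofReal hi (Eventually.of_forall fun a => sq_nonneg _),
    ← ENNReal.ofReal_add (sq_nonneg _) (integral_nonneg fun a => (sq_nonneg _).trans (hle a)), hexp,
    integral_add hi1 hsq, integral_add (integrable_const _) (hint.const_mul _), integral_const_mul,
    h0]
  refine ENNReal.ofReal_le_ofReal ?_
  have := integral_mono hsq hS hle
  simpa using this

/-! ### A law of large numbers from second moments along the squares -/

/-- At time m = (n + 1)² the mean square of Y/m is at most K/m, which is summable in n. So the sum
of the squares is almost surely finite and its terms tend to 0. -/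
lemma ae_tendsto_div_of_lintegral_sq_le {Ω : Type*} [MeasurableSpace Ω] {P : Measure Ω}
    {Y : ℕ → Ω → ℝ} (hY : ∀ n, AEMeasurable (Y n) P) {K : ℝ}
    (hK : ∀ n : ℕ, ∫⁻ s, ENNReal.ofReal (Y n s ^ 2) ∂P ≤ n * ENNReal.ofReal K) :
    ∀ᵐ s ∂P, Tendsto (fun n : ℕ => Y ((n + 1) ^ 2) s / ((n + 1) ^ 2 : ℕ)) atTop (𝓝 0) := by
  have hm : ∀ n : ℕ, AEMeasurable
      (fun s => ENNReal.ofReal ((Y ((n + 1) ^ 2) s / ((n + 1) ^ 2 : ℕ)) ^ 2)) P := fun n =>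
    (((hY _).div_const _).pow_const 2).ennreal_ofReal
  have hb : ∀ n : ℕ, ∫⁻ s, ENNReal.ofReal ((Y ((n + 1) ^ 2) s / ((n + 1) ^ 2 : ℕ)) ^ 2) ∂P ≤
      ENNReal.ofReal (K * (1 / ((n + 1 : ℕ) : ℝ) ^ 2)) := fun n => by
    have h1 : ∀ s, ENNReal.ofReal ((Y ((n + 1) ^ 2) s / ((n + 1) ^ 2 : ℕ)) ^ 2) =
        ENNReal.ofReal (1 / ((((n + 1) ^ 2 : ℕ) : ℝ)) ^ 2) *
          ENNReal.ofReal (Y ((n + 1) ^ 2) s ^ 2) := fun s => by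
      rw [← ENNReal.ofReal_mul (by positivity)]
      congr 1
      ring
    simp_rw [h1]
    rw [lintegral_const_mul' _ _ ENNReal.ofReal_ne_top]
    refine (mul_le_mul_right (hK _) _).trans (le_of_eq ?_)
    rw [← ENNReal.ofReal_natCast, ← ENNReal.ofReal_mul (by positivity),
      ← ENNReal.ofReal_mul (by positivity)]
    congr 1
    push_cast
    field_simp
  have hsum :
      ∫⁻ s, ∑' n : ℕ, ENNReal.ofReal ((Y ((n + 1) ^ 2) s / ((n + 1) ^ 2 : ℕ)) ^ 2) ∂P ≠ ⊤ := by
    rw [lintegral_tsum hm]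
    refine ne_top_of_le_ne_top ?_ (ENNReal.tsum_le_tsum hb)
    refine Summable.tsum_ofReal_ne_top (Summable.mul_left K ?_)
    exact (summable_nat_add_iff 1).2 (Real.summable_one_div_nat_pow.2 one_lt_two)
  filter_upwards [ae_lt_top' (AEMeasurable.tsum hm) hsum] with s hs
  have h1 := ENNReal.tendsto_atTop_zero_of_tsum_ne_top hs.ne
  have h2 := (ENNReal.tendsto_toReal ENNReal.zero_ne_top).comp h1
  have h3 : Tendsto (fun n : ℕ => (Y ((n + 1) ^ 2) s / ((n + 1) ^ 2 : ℕ)) ^ 2) atTop (𝓝 0) := by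
    refine h2.congr fun n => ?_
    simp only [Function.comp]
    rw [ENNReal.toReal_ofReal (sq_nonneg _)]
  have h4 := h3.sqrt
  simp only [Real.sqrt_sq_eq_abs, Real.sqrt_zero] at h4
  exact (tendsto_zero_iff_abs_tendsto_zero _).2 h4

/-- Ratios of consecutive squares tend to 1, so monotonicity controls the values in between. -/
lemma tendsto_div_of_monotone_of_tendsto_sq {u : ℕ → ℝ} {l : ℝ} (hu : Monotone u)
    (h : Tendsto (fun n : ℕ => u ((n + 1) ^ 2) / ((n + 1) ^ 2 : ℕ)) atTop (𝓝 l)) :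
    Tendsto (fun n : ℕ => u n / n) atTop (𝓝 l) := by
  refine tendsto_div_of_monotone_of_exists_subseq_tendsto_div u l hu fun a ha =>
    ⟨fun n => (n + 1) ^ 2, ?_, ?_, h⟩
  · have h1 : Tendsto (fun n : ℕ => (1 + 1 / ((n : ℝ) + 1)) ^ 2) atTop (𝓝 1) := by
      have := (tendsto_one_div_add_atTop_nhds_zero_nat (𝕜 := ℝ)).const_add 1
      simpa using this.pow 2
    filter_upwards [h1.eventually_le_const ha] with n hn
    have h2 : (((n + 1 + 1) ^ 2 : ℕ) : ℝ) =
        (1 + 1 / ((n : ℝ) + 1)) ^ 2 * ((n + 1) ^ 2 : ℕ) := by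
      push_cast
      field_simp
    rw [h2]
    exact mul_le_mul_of_nonneg_right hn (by positivity)
  · exact (tendsto_pow_atTop two_ne_zero).comp (tendsto_add_atTop_nat 1)

/-! ### The trajectory as a random process -/

lemma measurable_mulVec_noiseMatrix :
    Measurable fun p : (Fin 2 → ℝ) × ((ℝ × ℝ) × (ℝ × ℝ)) => mulVec (noiseMatrix p.2) p.1 := by
  refine measurable_pi_iff.2 fun i => ?_
  fin_cases i <;> simp only [mulVec, noiseMatrix] <;> simp <;> fun_prop

lemma measurable_state {α : Type*} [MeasurableSpace α] {B : ℕ+ → α → Matrix (Fin 2) (Fin 2) ℝ}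
    (hB : ∀ k i j, Measurable fun a => B k a i j) (n : ℕ) :
    Measurable fun a => state (fun k => B k a) n := by
  induction n with
  | zero => exact measurable_const
  | succ n ih =>
    refine measurable_pi_iff.2 fun i => ?_
    simp only [state, mulVec]
    have := fun j => hB n.succPNat i j
    have h0 := (measurable_pi_apply (0 : Fin 2)).comp ih
    have h1 := (measurable_pi_apply (1 : Fin 2)).comp ih
    exact (h0.add (this 0)).max (h1.add (this 1))

lemma state_congr {A A' : ℕ+ → Matrix (Fin 2) (Fin 2) ℝ} {n : ℕ}
    (h : ∀ m < n, A m.succPNat = A' m.succPNat) : state A n = state A' n := by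
  induction n with
  | zero => rfl
  | succ n ih =>
    simp only [state]
    rw [h n n.lt_succ_self, ih fun m hm => h m (hm.trans n.lt_succ_self)]

lemma monotone_max_state {A : ℕ+ → Matrix (Fin 2) (Fin 2) ℝ} (hA : ∀ k i j, 0 ≤ A k i j) :
    Monotone fun k => max (state A k 0) (state A k 1) := by
  refine monotone_nat_of_le_succ fun n => ?_
  simp only [state, mulVec]
  have h0 := hA n.succPNat 0 0
  have h1 := hA n.succPNat 1 1
  refine max_le_max ((le_max_left _ _).trans' ?_) ((le_max_right _ _).trans' ?_) <;> linarith

/-- The entries of a matrix, as a pair of rows. -/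
def entries (M : Matrix (Fin 2) (Fin 2) ℝ) : (ℝ × ℝ) × (ℝ × ℝ) :=
  ((M 0 0, M 0 1), (M 1 0, M 1 1))

lemma noiseMatrix_entries (M : Matrix (Fin 2) (Fin 2) ℝ) : noiseMatrix (entries M) = M := by
  ext i j
  fin_cases i <;> fin_cases j <;> rfl

/-! ### The Markov property and the law of large numbers -/

namespace IsExponentialSystem

variable {Ω : Type*} [MeasurableSpace Ω] {P : Measure Ω} [IsProbabilityMeasure P]
  {A : ℕ+ → Ω → Matrix (Fin 2) (Fin 2) ℝ} {μ ν σ τ : ℝ}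

omit [IsProbabilityMeasure P] in
lemma aemeasurable (hA : IsExponentialSystem P A μ ν σ τ) (p : ℕ+ × Fin 2 × Fin 2) :
    AEMeasurable (fun s => A p.1 s p.2.1 p.2.2) P := by
  obtain ⟨k, i, j⟩ := p
  fin_cases i <;> fin_cases j
  · exact (hA.law_alpha k).aemeasurable
  · exact (hA.law_beta k).aemeasurable
  · exact (hA.law_gamma k).aemeasurable
  · exact (hA.law_delta k).aemeasurable

omit [IsProbabilityMeasure P] in
lemma aemeasurable_state (hA : IsExponentialSystem P A μ ν σ τ) (n : ℕ) :
    AEMeasurable (fun s => state (fun k => A k s) n) P := by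
  -- The entries are only almost everywhere measurable, so the recursion is run on measurable
  -- versions of them.
  refine ⟨fun s => state (fun k => Matrix.of fun i j => (hA.aemeasurable (k, i, j)).mk _ s) n,
    measurable_state (fun k i j => (hA.aemeasurable (k, i, j)).measurable_mk) n, ?_⟩
  have h : ∀ᵐ s ∂P, ∀ p : ℕ+ × Fin 2 × Fin 2,
      A p.1 s p.2.1 p.2.2 = (hA.aemeasurable p).mk _ s :=
    ae_all_iff.2 fun p => (hA.aemeasurable p).ae_eq_mk
  filter_upwards [h] with s hs
  refine state_congr fun m _ => ?_
  ext i j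
  exact hs (m.succPNat, i, j)

lemma hasLaw_entries (hA : IsExponentialSystem P A μ ν σ τ) (k : ℕ+) :
    HasLaw (fun s => entries (A k s)) (noiseLaw μ ν σ τ) P := by
  have h1 : IndepFun (fun s => A k s 0 0) (fun s => A k s 0 1) P :=
    hA.indep.indepFun (i := (k, 0, 0)) (j := (k, 0, 1)) (by simp)
  have h2 : IndepFun (fun s => A k s 1 0) (fun s => A k s 1 1) P :=
    hA.indep.indepFun (i := (k, 1, 0)) (j := (k, 1, 1)) (by simp)
  have h3 := hA.indep.indepFun_prodMk_prodMk₀ hA.aemeasurable (k, 0, 0) (k, 0, 1) (k, 1, 0)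
    (k, 1, 1) (by simp) (by simp) (by simp) (by simp)
  exact (indepFun_iff_hasLaw_prodMk_prod
    ((indepFun_iff_hasLaw_prodMk_prod (hA.law_alpha k) (hA.law_beta k)).1 h1)
    ((indepFun_iff_hasLaw_prodMk_prod (hA.law_gamma k) (hA.law_delta k)).1 h2)).1 h3

omit [IsProbabilityMeasure P] in
lemma indepFun_state_entries (hA : IsExponentialSystem P A μ ν σ τ) (n : ℕ) :
    IndepFun (fun s => state (fun k => A k s) n) (fun s => entries (A n.succPNat s)) P := by
  classical
  -- The state at time n uses the matrices 1, …, n, while `n.succPNat` is the index n + 1.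
  set S : Finset (ℕ+ × Fin 2 × Fin 2) := ((Finset.range n).image Nat.succPNat) ×ˢ Finset.univ
    with hS
  set T : Finset (ℕ+ × Fin 2 × Fin 2) := {n.succPNat} ×ˢ Finset.univ with hT
  have hST : Disjoint S T := by
    rw [Finset.disjoint_left]
    rintro ⟨k, i, j⟩ h1 h2
    simp only [hS, hT, Finset.mem_product, Finset.mem_image, Finset.mem_range, Finset.mem_univ,
      and_true, Finset.mem_singleton] at h1 h2
    obtain ⟨m, hm, rfl⟩ := h1
    exact hm.ne (Nat.succPNat_injective h2)
  have hTmem : ∀ i j, (n.succPNat, i, j) ∈ T := fun i j => by simp [hT]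
  have h := hA.indep.indepFun_finset₀ S T hST hA.aemeasurable
  -- The default 0 fills the later matrices, which the first n steps never read.
  have hφ : Measurable fun v : S → ℝ => state (fun k => Matrix.of fun i j =>
      if h : (k, i, j) ∈ S then v ⟨(k, i, j), h⟩ else 0) n := by
    refine measurable_state (fun k i j => ?_) n
    by_cases hk : (k, i, j) ∈ S
    · simp only [Matrix.of_apply, hk, dif_pos]
      fun_prop
    · simp only [Matrix.of_apply, hk, dif_neg, not_false_eq_true]
      fun_prop
  have hψ : Measurable fun v : T → ℝ =>
      ((v ⟨_, hTmem 0 0⟩, v ⟨_, hTmem 0 1⟩), (v ⟨_, hTmem 1 0⟩, v ⟨_, hTmem 1 1⟩)) := by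
    fun_prop
  convert! h.comp hφ hψ using 1
  ext1 s
  refine state_congr fun m hm => ?_
  ext i j
  have : (m.succPNat, i, j) ∈ S := by
    simp only [hS, Finset.mem_product, Finset.mem_image, Finset.mem_range, Finset.mem_univ,
      and_true]
    exact ⟨m, hm, rfl⟩
  simp [this]

/-- The Markov property: the fresh matrix is independent of the present state. The form with values
in `ENNReal` needs no integrability. -/
lemma lintegral_state_succ (hA : IsExponentialSystem P A μ ν σ τ)
    [IsProbabilityMeasure (noiseLaw μ ν σ τ)] (n : ℕ) {F : (Fin 2 → ℝ) → ENNReal}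
    (hF : Measurable F) :
    ∫⁻ s, F (state (fun k => A k s) (n + 1)) ∂P =
      ∫⁻ s, ∫⁻ a, F (mulVec (noiseMatrix a) (state (fun k => A k s) n)) ∂noiseLaw μ ν σ τ ∂P := by
  have hz := hA.aemeasurable_state n
  have hlaw := (indepFun_iff_hasLaw_prodMk_prod ⟨hz, rfl⟩ (hA.hasLaw_entries n.succPNat)).1
    (hA.indepFun_state_entries n)
  have hFm : Measurable fun p : (Fin 2 → ℝ) × ((ℝ × ℝ) × (ℝ × ℝ)) =>
      F (mulVec (noiseMatrix p.2) p.1) := hF.comp measurable_mulVec_noiseMatrix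
  have : IsProbabilityMeasure (P.map fun s => state (fun k => A k s) n) :=
    Measure.isProbabilityMeasure_map hz
  calc ∫⁻ s, F (state (fun k => A k s) (n + 1)) ∂P =
      ∫⁻ s, F (mulVec (noiseMatrix (entries (A n.succPNat s))) (state (fun k => A k s) n)) ∂P := by
        simp only [noiseMatrix_entries, state]
    _ = ∫⁻ p, F (mulVec (noiseMatrix p.2) p.1)
          ∂((P.map fun s => state (fun k => A k s) n).prod (noiseLaw μ ν σ τ)) :=
        hlaw.lintegral_comp hFm.aemeasurable
    _ = ∫⁻ z, ∫⁻ a, F (mulVec (noiseMatrix a) z) ∂noiseLaw μ ν σ τ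
          ∂(P.map fun s => state (fun k => A k s) n) := lintegral_prod _ hFm.aemeasurable
    _ = _ := lintegral_map' hFm.lintegral_prod_right'.aemeasurable hz

omit [IsProbabilityMeasure P] in
lemma ae_nonneg (hA : IsExponentialSystem P A μ ν σ τ) (hμ : 0 < μ) (hν : 0 < ν) (hσ : 0 < σ)
    (hτ : 0 < τ) : ∀ᵐ s ∂P, ∀ k i j, 0 ≤ A k s i j := by
  have key : ∀ {X : Ω → ℝ} {r : ℝ}, 0 < r → HasLaw X (expMeasure r) P → ∀ᵐ s ∂P, 0 ≤ X s :=
    fun {X r} hr hX => by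
      have h : ∀ᵐ x ∂P.map X, 0 ≤ x := by
        rw [hX.map_eq]
        exact (ae_pos_expMeasure hr).mono fun x hx => hx.le
      exact ae_of_ae_map hX.aemeasurable h
  refine ae_all_iff.2 fun k => ae_all_iff.2 fun i => ae_all_iff.2 fun j => ?_
  fin_cases i <;> fin_cases j
  · exact key hμ (hA.law_alpha k)
  · exact key hν (hA.law_beta k)
  · exact key hσ (hA.law_gamma k)
  · exact key hτ (hA.law_delta k)

/-- `max x y` corrected by a function of `y - x` solving the Poisson equation is, up to the drift
`lam`, a martingale with square integrable increments; this gives the Lyapunov exponent. -/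
lemma isLyapunovExponent_of_poisson (hA : IsExponentialSystem P A μ ν σ τ) (hμ : 0 < μ)
    (hν : 0 < ν) (hσ : 0 < σ) (hτ : 0 < τ) {c : Fin 4 ⊕ Fin 4 → ℝ} {lam : ℝ}
    (hc : c ᵥ* W μ ν σ τ = c - Sum.elim (q₁ μ ν σ τ) (q₂ μ ν σ τ) + lam • totalMass) :
    IsLyapunovExponent P A lam := by
  have hP := isProbabilityMeasure_noiseLaw hμ hν hσ hτ
  set g : ℝ → ℝ := fun d => c ⬝ᵥ expBasis μ ν σ τ d with hg
  have hgm : Measurable g := measurable_dotProduct_expBasis μ ν σ τ c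
  set C : ℝ := ∑ i, |c i| with hC
  have hgC : ∀ d, |g d| ≤ C := abs_dotProduct_expBasis_le hμ hν hσ hτ c
  -- The corrector g is bounded, so ψ and max(x, y) have the same growth rate.
  set ψ : (Fin 2 → ℝ) → ℝ := fun z => max (z 0) (z 1) + g (z 1 - z 0) with hψ
  have hψm : Measurable ψ := by fun_prop
  set ξ : ℝ → (ℝ × ℝ) × (ℝ × ℝ) → ℝ := fun d a => maxIncr d a + g (nextDiff d a) - g d - lam
    with hξ
  have hstep : ∀ z a, ψ (mulVec (noiseMatrix a) z) = ψ z + lam + ξ (z 1 - z 0) a := fun z a => by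
    simp only [hψ, hξ, mulVec_max, mulVec_diff]
    ring
  have hsq := integrable_sq_noiseLaw hμ hν hσ hτ
  have hincr2 : ∀ d, Integrable (fun a => maxIncr d a ^ 2) (noiseLaw μ ν σ τ) := fun d => by
    refine Integrable.mono' (hsq.const_mul 4)
      ((measurable_maxIncr d).pow_const 2).aestronglyMeasurable (Eventually.of_forall fun a => ?_)
    rw [Real.norm_of_nonneg (sq_nonneg _), ← sq_abs]
    have h1 := pow_le_pow_left₀ (abs_nonneg _) (abs_maxIncr_le d a) 2
    have h2 := sq_sum_le_card_mul_sum_sq (s := Finset.univ)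
      (f := ![|a.1.1|, |a.1.2|, |a.2.1|, |a.2.2|])
    simp [Fin.sum_univ_four] at h2
    rw [sq_abs] at h1 ⊢
    exact h1.trans h2
  have hincr : ∀ d, Integrable (maxIncr d) (noiseLaw μ ν σ τ) := fun d =>
    ((memLp_two_iff_integrable_sq (measurable_maxIncr d).aestronglyMeasurable).2
      (hincr2 d)).integrable one_le_two
  have hξm : ∀ d, Measurable (ξ d) := fun d =>
    (((measurable_maxIncr d).add (hgm.comp (measurable_nextDiff d))).sub_const _).sub_const _
  -- The Poisson equation is used here: q + cW - c - `lam`·`totalMass` = 0, paired with the basis at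
  -- d.
  have hξ0 : ∀ d, ∫ a, ξ d a ∂noiseLaw μ ν σ τ = 0 := fun d => by
    have hi : Integrable (fun a => g (nextDiff d a)) (noiseLaw μ ν σ τ) :=
      integrable_dotProduct_expBasis_comp hμ hν hσ hτ (measurable_nextDiff d) c
    have hi2 : Integrable (fun a => maxIncr d a + g (nextDiff d a)) (noiseLaw μ ν σ τ) :=
      (hincr d).add hi
    have hi3 : Integrable (fun a => maxIncr d a + g (nextDiff d a) - g d) (noiseLaw μ ν σ τ) :=
      hi2.sub (integrable_const _)
    have e1 : ∫ a, g (nextDiff d a) ∂noiseLaw μ ν σ τ = (c ᵥ* W μ ν σ τ) ⬝ᵥ expBasis μ ν σ τ d :=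
      integral_dotProduct_expBasis_nextDiff hμ hν hσ hτ c d
    have e2 : Sum.elim (q₁ μ ν σ τ) (q₂ μ ν σ τ) ⬝ᵥ expBasis μ ν σ τ d =
        q₁ μ ν σ τ ⬝ᵥ (fun i => expBasis μ ν σ τ d (Sum.inl i)) +
        q₂ μ ν σ τ ⬝ᵥ (fun i => expBasis μ ν σ τ d (Sum.inr i)) := by
      simp [dotProduct, Fintype.sum_sum_type]
    rw [hξ]
    simp only
    rw [integral_sub hi3 (integrable_const _), integral_sub hi2 (integrable_const _),
      integral_add (hincr d) hi, e1, integral_maxIncr hμ hν hσ hτ, ← e2, hc, add_dotProduct,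
      sub_dotProduct, smul_dotProduct, totalMass_dotProduct_expBasis]
    simp [hg]
    ring
  -- A majorant of ξ² that does not depend on d; the factor 5 is Cauchy–Schwarz for five summands.
  set S : (ℝ × ℝ) × (ℝ × ℝ) → ℝ := fun a =>
    5 * ((2 * C + |lam|) ^ 2 + (a.1.1 ^ 2 + a.1.2 ^ 2 + a.2.1 ^ 2 + a.2.2 ^ 2)) with hS
  have hSi : Integrable S (noiseLaw μ ν σ τ) := ((integrable_const _).add hsq).const_mul 5
  have hξS : ∀ d a, ξ d a ^ 2 ≤ S a := fun d a => by
    have h1 : |ξ d a| ≤ (2 * C + |lam|) + (|a.1.1| + |a.1.2| + |a.2.1| + |a.2.2|) := by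
      have e1 := abs_le.1 (abs_maxIncr_le d a)
      have e2 := abs_le.1 (hgC d)
      have e3 := abs_le.1 (hgC (nextDiff d a))
      have e4 := abs_le.1 (le_refl |lam|)
      simp only [hξ]
      rw [abs_le]
      constructor <;> linarith
    have h2 := pow_le_pow_left₀ (abs_nonneg _) h1 2
    rw [sq_abs] at h2
    refine h2.trans ?_
    have h3 := sq_sum_le_card_mul_sum_sq (s := Finset.univ)
      (f := ![2 * C + |lam|, |a.1.1|, |a.1.2|, |a.2.1|, |a.2.2|])
    simp [Fin.sum_univ_five] at h3
    simp only [hS]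
    simpa only [add_assoc] using h3
  set K : ℝ := ∫ a, S a ∂noiseLaw μ ν σ τ with hK
  set Y : ℕ → Ω → ℝ := fun n s => ψ (state (fun k => A k s) n) - ψ 0 - n * lam with hY
  have hYm : ∀ n, AEMeasurable (Y n) P := fun n =>
    ((hψm.comp_aemeasurable (hA.aemeasurable_state n)).sub_const _).sub_const _
  -- Given the present state the new increment is centred, so the cross term vanishes and each step
  -- adds at most K.
  have hYK : ∀ n : ℕ, ∫⁻ s, ENNReal.ofReal (Y n s ^ 2) ∂P ≤ n * ENNReal.ofReal K := by
    intro n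
    induction n with
    | zero => simp [hY, state]
    | succ n ih =>
      have hF : Measurable fun z => ENNReal.ofReal ((ψ z - ψ 0 - (n + 1 : ℕ) * lam) ^ 2) := by
        fun_prop
      have h1 := hA.lintegral_state_succ n hF
      simp only [hY]
      rw [h1]
      calc _ ≤ ∫⁻ s, (ENNReal.ofReal (Y n s ^ 2) + ENNReal.ofReal K) ∂P := by
            refine lintegral_mono fun s => ?_
            have h2 := lintegral_sq_add_le
              (hξm (state (fun k => A k s) n 1 - state (fun k => A k s) n 0)).aestronglyMeasurable
              hSi (hξS _) (hξ0 _) (Y n s)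
            refine le_trans (le_of_eq ?_) h2
            refine lintegral_congr fun a => ?_
            rw [hstep]
            simp only [hY]
            congr 2
            push_cast
            ring
        _ = ∫⁻ s, ENNReal.ofReal (Y n s ^ 2) ∂P + ENNReal.ofReal K := by
            rw [lintegral_add_right _ measurable_const]
            simp
        _ ≤ n * ENNReal.ofReal K + ENNReal.ofReal K := by gcongr
        _ = _ := by push_cast; ring
  filter_upwards [ae_tendsto_div_of_lintegral_sq_le hYm hYK, hA.ae_nonneg hμ hν hσ hτ]
    with s hs hnn
  have hsqt : Tendsto (fun n : ℕ => (((n + 1) ^ 2 : ℕ) : ℝ)) atTop atTop :=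
    tendsto_natCast_atTop_atTop.comp
      ((tendsto_pow_atTop two_ne_zero).comp (tendsto_add_atTop_nat 1))
  have hrem : Tendsto (fun n : ℕ => (ψ 0 - g (state (fun k => A k s) ((n + 1) ^ 2) 1 -
      state (fun k => A k s) ((n + 1) ^ 2) 0)) / ((n + 1) ^ 2 : ℕ)) atTop (𝓝 0) := by
    refine squeeze_zero_norm (a := fun n : ℕ => (|ψ 0| + C) / ((n + 1) ^ 2 : ℕ)) (fun n => ?_)
      (hsqt.const_div_atTop _)
    rw [norm_div, Real.norm_eq_abs, Real.norm_natCast]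
    gcongr
    exact (abs_sub _ _).trans (add_le_add le_rfl (hgC _))
  have hmain := tendsto_div_of_monotone_of_tendsto_sq (l := lam) (monotone_max_state hnn) (by
    have h := (hs.add hrem).add_const lam
    simp only [zero_add] at h
    refine h.congr fun n => ?_
    have : (((n + 1) ^ 2 : ℕ) : ℝ) ≠ 0 := by positivity
    simp only [hY, hψ]
    field_simp
    ring)
  refine hmain.congr fun n => ?_
  ring

end IsExponentialSystem

end

end MaxPlus

theorem mainTheorem1 {Ω : Type*} [MeasurableSpace Ω] (P : Measure Ω) [IsProbabilityMeasure P]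
    (A : ℕ+ → Ω → Matrix (Fin 2) (Fin 2) ℝ) (μ ν σ τ : ℝ)
    (hμ : 0 < μ) (hν : 0 < ν) (hσ : 0 < σ) (hτ : 0 < τ)
    (hA : MaxPlus.IsExponentialSystem P A μ ν σ τ) :
    (∃! ω : Fin 4 ⊕ Fin 4 → ℝ, MaxPlus.IsSolution μ ν σ τ ω) ∧
    ∀ ω : Fin 4 ⊕ Fin 4 → ℝ, MaxPlus.IsSolution μ ν σ τ ω →
      MaxPlus.IsLyapunovExponent P A
        (MaxPlus.q₁ μ ν σ τ ⬝ᵥ (fun i => ω (Sum.inl i)) +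
          MaxPlus.q₂ μ ν σ τ ⬝ᵥ (fun i => ω (Sum.inr i))) := by
  refine ⟨MaxPlus.existsUnique_isSolution hμ hν hσ hτ, fun ω hω => ?_⟩
  obtain ⟨c, hc⟩ := MaxPlus.exists_poisson hμ hν hσ hτ hω
    (Sum.elim (MaxPlus.q₁ μ ν σ τ) (MaxPlus.q₂ μ ν σ τ))
  have hq : Sum.elim (MaxPlus.q₁ μ ν σ τ) (MaxPlus.q₂ μ ν σ τ) ⬝ᵥ ω =
      MaxPlus.q₁ μ ν σ τ ⬝ᵥ (fun i => ω (Sum.inl i)) +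
        MaxPlus.q₂ μ ν σ τ ⬝ᵥ (fun i => ω (Sum.inr i)) := by
    simp [dotProduct, Fintype.sum_sum_type]
  rw [hq] at hc
  exact hA.isLyapunovExponent_of_poisson hμ hν hσ hτ hc
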